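/- **Conventions.** Let $p$ be a prime and let $K$ be a field that is complete with respect to a (rank one) discrete valuation, with residue field $\overline K$ of characteristic $p$ such that $[\overline K:\overline K^p]=p$. Fix an algebraic closure $\Omega$ of $K$ with the prolonged valuation $v$; all fields below are subfields of $\Omega$ containing $K$ or constructed inside $\Omega$, and $\mathcal O_E$, $\overline E$ denote the valuation ring and residue field of $E$. If $\operatorname{char}K=p$, fix also a base subfield $B\subset K$: a complete subfield, nontrivially valued, with residue field $\mathbb F_p$ (so $B=\mathbb F_p((\tau))$ with $v(\tau)>0$). For a finite extension $E$ of $K$ let $F_E=\bigcap_n \overline E^{\,p^n}$ and let $\mathcal R_E\subset\mathcal O_E$ be the set of Teichmüller representatives of $F_E$ (the integers of $E$ that are $p^n$-th powers in $E$ for all $n$). Let $k_0(E)$ be the completion of $B(\mathcal R_E)$ if $\operatorname{char}K=p$, and the fraction field of $W(F_E)$, embedded in $E$ (i.e. the closure of $\mathbb Q(\mathcal R_E)$), if $\operatorname{char}K=0$. The *constant subfield* $k(E)$ is the algebraic closure of $k_0(E)$ in $E$; $v_0$ is the valuation equivalent to $v$ whose restriction to $k_0(E)$ is normalized. $E$ is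 *standard* if $e(E/k(E))=1$. An extension $E'/E$ is *unramified* if $e(E'/E)=1$ and $\overline{E'}/\overline E$ is separable; *constant* if $E'=lE$ with $l/k(E)$ algebraic; *almost constant* if it is contained in the compositum of a constant and an unramified extension of $E$. Every finite extension has a maximal almost constant subextension. **Filtration.** Let $\mathbb I=\{-1,0\}\cup\{(\mathbf c,i): i\in\mathbb Q_{>0}\}\cup\{(\mathbf c,\infty)\}\cup\{(\mathbf i,i): i\in\mathbb Q_{>0}\}\cup\{\infty\}$. Let $L/E$ be a finite Galois extension with group $G$, where $E/K$ is finite, and let $E_{\mathbf c}$ be its maximal almost constant subextension. A finite unramified extension $E'/E$ is *admissible* for $L/E$ if $E'L/E'$ has no nontrivial unramified subextension and the maximal almost constant subextension of $E'L/E'$ is constant. For an admissible $E'$ define $G_\alpha\subseteq G$, $\alpha\in\mathbb I$, by: * $G_{-1}=G$; $G_0=\{g: v(g(a)-a)>0\ \text{for all } a\in\mathcal O_L\}$; $G_\infty=\{1\}$; $G_{\mathbf c,\infty}=\operatorname{Gal}(L/E_{\mathbf c})$; * $G_{\mathbf c,i}$ is the set of restrictions to $L$ of those elements of $\operatorname{Gal}(E'L/E')$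 whose image in $\operatorname{Gal}(l/k)$, $l=k(E'L)$, $k=k(E')$, lies in the classical lower ramification group $\operatorname{Gal}(l/k)_i=\{\sigma : v_l(\sigma a-a)\ge i+1\ \text{for all } a\in\mathcal O_l\}$, where $v_l$ is the normalized valuation of $l$; * $G_{\mathbf i,i}$ is the set of restrictions to $L$ of those $\sigma\in\operatorname{Gal}(l'L/l'E_{\mathbf c})$ with $v_0(\sigma(t)-t)\ge i$, where $l'$ is a finite extension of $k(L)$ such that $l'E_{\mathbf c}$ is standard and $e(l'L/l'E_{\mathbf c})=1$, and $t\in\mathcal O_{l'L}$ has residue class not in $\overline{l'L}^{\,p}$ (an element $g$ belongs to $G_{\mathbf i,i}$ if this holds for some such $l'$, $\sigma$ and $t$). **Proposition 1.2.** Let $L/K$ be a finite Galois extension with $G=\operatorname{Gal}(L/K)$, let $H$ be a subgroup of $G$ and $M=L^H$, so that $H=\operatorname{Gal}(L/M)$. Admissible extensions for $L/K$ exist. If $K'$ is any admissible extension for $L/K$, then $K'M$ is an admissible extension for $L/M$, and, for the filtration of $G$ formed with $K'$ and the filtration of $H$ formed with $K'M$, $$H_\alpha=H\cap G_\alpha\qquad\text{for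 all }\alpha\in\mathbb I .$$ -/

import Mathlib

open scoped NNReal

noncomputable section

namespace LowerRamification

/-! ### The prolonged valuation -/

/-- The (multiplicatively written, rank one) valuation on an algebraic extension `Ω` of a complete
nonarchimedean field `K` that prolongs the absolute value of `K`; it is given by the spectral
norm. -/
def prolongedValuation (K Ω : Type*) [NontriviallyNormedField K] [CompleteSpace K]
    [IsUltrametricDist K] [Field Ω] [Algebra K Ω] [Algebra.IsAlgebraic K Ω] :
    Valuation Ω ℝ≥0 where
  toFun x := ⟨spectralNorm K Ω x, spectralNorm_nonneg x⟩
  map_zero' := by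
    apply NNReal.eq
    exact spectralNorm_zero
  map_one' := by
    apply NNReal.eq
    exact spectralNorm_one
  map_mul' x y := by
    apply NNReal.eq
    exact spectralAlgNorm_mul x y
  map_add_le_max' x y := by
    rcases le_max_iff.1 (isNonarchimedean_spectralNorm (K := K) (L := Ω) x y) with h | h
    · exact le_max_of_le_left h
    · exact le_max_of_le_right h

theorem prolongedValuation_algebraMap {K Ω : Type*} [NontriviallyNormedField K] [CompleteSpace K]
    [IsUltrametricDist K] [Field Ω] [Algebra K Ω] [Algebra.IsAlgebraic K Ω] (x : K) :
    prolongedValuation K Ω (algebraMap K Ω x) = ‖x‖₊ := by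
  apply NNReal.eq
  exact spectralNorm_extends x

/-- A base subfield of a complete discretely valued field `K` of characteristic `p`: a complete
(that is, closed) subfield on which the valuation is nontrivial and whose residue field is the prime
field. These are the subfields `𝔽_p((τ))` with `0 < ‖τ‖ < 1`. -/
def IsBaseSubfield {K : Type*} [NontriviallyNormedField K] (B : Subfield K) : Prop :=
  IsClosed (B : Set K) ∧ (∃ τ ∈ B, 0 < ‖τ‖ ∧ ‖τ‖ < 1) ∧
    ∀ b ∈ B, ‖b‖ ≤ 1 → ∃ n : ℕ, ‖b - (n : K)‖ < 1

section Subfields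

/-! ### Subfields of a valued field

All fields occurring below are subfields `E`, `F` of one field `Ω` (an algebraic closure of the
ground field) and carry the restriction of one valuation `v` of `Ω`. -/

variable {Ω : Type*} [Field Ω] (v : Valuation Ω ℝ≥0)

/-- The residue field of the subfield `E`, as a subfield of the residue field of `Ω`. -/
def residueSubfield (E : Subfield Ω) :
    Subfield (IsLocalRing.ResidueField v.valuationSubring) where
  toSubring := (E.toSubring.comap v.valuationSubring.subtype).map
    (IsLocalRing.residue v.valuationSubring)
  inv_mem' := by
    rintro _ ⟨x, hx, rfl⟩
    by_cases h0 : IsLocalRing.residue v.valuationSubring x = 0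
    · exact ⟨0, zero_mem (E.toSubring.comap v.valuationSubring.subtype), by simp [h0]⟩
    · have hu : IsUnit x := by
        by_contra hu
        exact h0 ((IsLocalRing.residue_eq_zero_iff x).2 ((IsLocalRing.mem_maximalIdeal x).2 hu))
      obtain ⟨u, rfl⟩ := hu
      have hx' : ((u : v.valuationSubring) : Ω) ∈ E := hx
      have hmul : ((u : v.valuationSubring) : Ω) * ((u⁻¹ : v.valuationSubringˣ) :
          v.valuationSubring) = 1 := by
        exact_mod_cast congrArg (Subtype.val) u.mul_inv
      have hinv : (((u⁻¹ : v.valuationSubringˣ) : v.valuationSubring) : Ω) ∈ E := by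
        rw [eq_inv_of_mul_eq_one_right hmul]
        exact inv_mem hx'
      refine ⟨((u⁻¹ : v.valuationSubringˣ) : v.valuationSubring), hinv, ?_⟩
      refine eq_inv_of_mul_eq_one_right ?_
      rw [← map_mul, u.mul_inv, map_one]

/-- `π` is a prime element of the (discretely valued) field `E`. -/
def IsUniformizer (E : Subfield Ω) (π : Ω) : Prop :=
  π ∈ E ∧ π ≠ 0 ∧ v π < 1 ∧ ∀ x ∈ E, v x < 1 → v x ≤ v π

/-- `F/E` is a finite extension. -/
def IsFiniteExt (E F : Subfield Ω) : Prop :=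
  E ≤ F ∧ E.relfinrank F ≠ 0

/-- `e(F/E) = 1`: every value of `F` is a value of `E`. -/
def HasRamificationIndexOne (E F : Subfield Ω) : Prop :=
  E ≤ F ∧ ∀ x ∈ F, ∃ y ∈ E, v x = v y

/-- `F/E` is unramified: the ramification index is one and the residue extension is separable. -/
def IsUnramifiedExt (E F : Subfield Ω) : Prop :=
  HasRamificationIndexOne v E F ∧
    ∀ a ∈ residueSubfield v F, IsSeparable (residueSubfield v E) a

/-! ### Constant subfields -/

variable (p : ℕ) (B : Subfield Ω)

/-- The multiplicative (Teichmüller) representatives in `E` of the elements of the maximal perfect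
subfield of the residue field of `E`: the integers of `E` that are `p ^ n`-th powers for all `n`. -/
def teichmullerSet (E : Subfield Ω) : Set Ω :=
  {x | x ∈ E ∧ v x ≤ 1 ∧ ∀ n : ℕ, ∃ y ∈ E, y ^ p ^ n = x}

/-- The topological closure of a subfield for the topology defined by `v`. -/
def closureSubfield (E : Subfield Ω) : Subfield Ω :=
  letI := Valued.mk' v
  E.topologicalClosure

open scoped Classical in
/-- The field `k₀` attached to a complete discretely valued field `E` with residue characteristic
`p`. If `Ω` has characteristic `p`, it is the completion of the field generated by the base subfield
`B` and the Teichmüller representatives. Otherwise it is the fraction field of the Witt vectors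
`W(F)` of the maximal perfect subfield `F` of the residue field, embedded in `E`: as the elements of
`W(F)` are the sums `∑ [aᵢ] pⁱ` with `aᵢ ∈ F`, this is the completion of the field generated by the
Teichmüller representatives. -/
def constantBase (E : Subfield Ω) : Subfield Ω :=
  if (p : Ω) = 0 then
    closureSubfield v (Subfield.closure ((B : Set Ω) ∪ teichmullerSet v p E))
  else
    closureSubfield v (Subfield.closure (teichmullerSet v p E))

/-- The constant subfield of `E`: all the elements of `E` that are algebraic over `k₀`. -/
def constantSubfield (E : Subfield Ω) : Subfield Ω :=
  (algebraicClosure (constantBase v p B E) Ω).toSubfield ⊓ E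

/-- `v₀ x ≥ i`, where `v₀` is the valuation of `E` whose restriction to `k₀` is the normalized
valuation of `k₀`. -/
def ConstValGE (E : Subfield Ω) (x : Ω) (i : ℚ) : Prop :=
  ∃ τ, IsUniformizer v (constantBase v p B E) τ ∧ v x ≤ v τ ^ (i : ℝ)

/-- `E` is standard: it has ramification index one over its constant subfield. -/
def IsStandard (E : Subfield Ω) : Prop :=
  HasRamificationIndexOne v (constantSubfield v p B E) E

/-- `F/E` is a constant extension: `F = lE` with `l` algebraic over the constant subfield of `E`. -/
def IsConstantExt (E F : Subfield Ω) : Prop :=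
  ∃ l : Subfield Ω, constantSubfield v p B E ≤ l ∧
    (∀ x ∈ l, IsAlgebraic (constantSubfield v p B E) x) ∧ F = l ⊔ E

/-- `F/E` is almost constant: it lies in the compositum of a constant extension and an unramified
one. -/
def IsAlmostConstantExt (E F : Subfield Ω) : Prop :=
  E ≤ F ∧ ∃ C U : Subfield Ω, IsConstantExt v p B E C ∧ IsUnramifiedExt v E U ∧ F ≤ C ⊔ U

/-- The maximal almost constant subextension of `F/E`. -/
def maxAlmostConstant (E F : Subfield Ω) : Subfield Ω :=
  sSup {T | T ≤ F ∧ IsAlmostConstantExt v p B E T}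

/-- The auxiliary extensions `E'/E` used to define the subgroups `G_{c,i}` of the Galois group of
`F/E`: `E'/E` is finite and unramified, `E'F/E'` contains no nontrivial unramified subextension, and
the maximal almost constant subextension of `E'F/E'` is constant. -/
def IsAdmissible (E F E' : Subfield Ω) : Prop :=
  IsFiniteExt E E' ∧ IsUnramifiedExt v E E' ∧
    (∀ T : Subfield Ω, T ≤ E' ⊔ F → IsUnramifiedExt v E' T → T = E') ∧
    IsConstantExt v p B E' (maxAlmostConstant v p B E' (E' ⊔ F))

end Subfields

/-! ### The lower ramification filtration -/

/-- The index set `{-1, 0} ∪ {(c,i) | i ∈ ℚ, i > 0} ∪ {(c,∞)} ∪ {(i,i) | i ∈ ℚ, i > 0} ∪ {∞}`. -/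
inductive RamIndex : Type
  | negOne : RamIndex
  | zero : RamIndex
  | const (i : ℚ) (hi : 0 < i) : RamIndex
  | constInfty : RamIndex
  | infernal (i : ℚ) (hi : 0 < i) : RamIndex
  | infty : RamIndex

section Galois

variable (A L : Type*) {Ω : Type*} [Field A] [Field L] [Algebra A L] [Field Ω] [Algebra L Ω]

/-- The image of `A` in `Ω`, for a tower `A → L → Ω`. -/
def imageSubfield (Ω : Type*) [Field Ω] [Algebra L Ω] : Subfield Ω :=
  ((algebraMap L Ω).comp (algebraMap A L)).fieldRange

variable {A L}

/-- The automorphism `σ` of `Ω` extends the automorphism `g` of `L`. -/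
def Extends (σ : Ω ≃+* Ω) (g : L ≃ₐ[A] L) : Prop :=
  ∀ x : L, σ (algebraMap L Ω x) = algebraMap L Ω (g x)

variable (v : Valuation Ω ℝ≥0) (p : ℕ) (B : Subfield Ω)

/-- `g ∈ G_{c,i}`, where `E'` is an admissible extension of (the image of) `A`: `g` is the
restriction of an element of `Gal(E'L/E')` whose image in `Gal(l/k)` lies in the classical lower
ramification group `Gal(l/k)_i`, where `l` and `k` are the constant subfields of `E'L` and `E'`.
Elements of `Gal(E'L/E')` are represented by automorphisms `σ` of `Ω`. -/
def InConst (E' : Subfield Ω) (i : ℚ) (g : L ≃ₐ[A] L) : Prop :=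
  ∃ σ : Ω ≃+* Ω, Extends σ g ∧ (∀ x ∈ E', σ x = x) ∧
    ∃ π, IsUniformizer v (constantSubfield v p B (E' ⊔ (algebraMap L Ω).fieldRange)) π ∧
      ∀ a ∈ constantSubfield v p B (E' ⊔ (algebraMap L Ω).fieldRange),
        v a ≤ 1 → v (σ a - a) ≤ v π ^ ((i : ℝ) + 1)

/-- `g ∈ G_{i,i}`. Write `Ac` for the maximal almost constant subextension of `L/A` and `l` for the
constant subfield of `L`. Then `g` is the restriction of an element of `Gal(l'L/l'Ac)`, where `l'/l`
is a finite extension such that `l'Ac` is standard and `e(l'L/l'Ac) = 1`, and this element moves by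
an amount of `v₀`-value at least `i` an integer `t` of `l'L` whose residue class is not a `p`-th
power in the residue field of `l'L`. -/
def InInfernal (i : ℚ) (g : L ≃ₐ[A] L) : Prop :=
  ∃ σ : Ω ≃+* Ω, Extends σ g ∧
    ∃ l' Ac' L' : Subfield Ω,
      IsFiniteExt (constantSubfield v p B (algebraMap L Ω).fieldRange) l' ∧
      Ac' = l' ⊔ maxAlmostConstant v p B (imageSubfield A L Ω) (algebraMap L Ω).fieldRange ∧
      L' = l' ⊔ (algebraMap L Ω).fieldRange ∧
      IsStandard v p B Ac' ∧ HasRamificationIndexOne v Ac' L' ∧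
      (∀ x ∈ Ac', σ x = x) ∧
      ∃ t ∈ L', v t ≤ 1 ∧ (∀ y ∈ L', v y ≤ 1 → ¬ v (t - y ^ p) < 1) ∧
        ConstValGE v p B L' (σ t - t) i

/-- The lower ramification filtration `G_α` of the Galois group `G` of `L/A`, as subsets of `G`,
computed with the admissible extension `E'` (which only matters for the indices `(c,i)`). -/
def ramificationGroup (E' : Subfield Ω) : RamIndex → Set (L ≃ₐ[A] L)
  | .negOne => Set.univ
  | .zero => {g | ∀ a : L, v (algebraMap L Ω a) ≤ 1 → v (algebraMap L Ω (g a - a)) < 1}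
  | .const i _ => {g | InConst v p B E' i g}
  | .constInfty => {g | ∀ x : L, algebraMap L Ω x ∈
      maxAlmostConstant v p B (imageSubfield A L Ω) (algebraMap L Ω).fieldRange → g x = x}
  | .infernal i _ => {g | InInfernal v p B i g}
  | .infty => {1}

end Galois

end LowerRamification

end

/-!
All fields are subfields of `Ω`, all Galois groups are represented by automorphisms of `Ω`.
Write `C` for the algebraic closure of `k₀(K)`, `U` for the maximal unramified extension of `K` and
`A = CU` for the largest almost constant extension of `K` in `Ω`. The theorem rests on two facts.

* These three fields control everything that happens over a finite extension `E` of `K`: the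
  constant subfield of `E` is `C ∩ E` (`constantSubfield_eq`), the unramified extensions of `E` are
  the extensions contained in `EU` (`isUnramifiedExt_iff`, `unramifiedClosure_eq_sup`), hence the
  maximal almost constant subextension of `F/E` is `F ∩ EA` (`maxAlmostConstant_eq`).
* The modular law (`IsGaloisExt.inf_sup_le`): if `L/K` is finite Galois, then
  `EL ∩ MA = EM(L ∩ A)` for `M ⊆ L` and `K ⊆ E ⊆ A`, as `Gal(LA/A)` restricts isomorphically onto
  `Gal(L/L ∩ A)`.

Stability of admissibility and the equality `M_c = M K_c` of maximal almost constant subextensions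
of `L` over `M` and over `K` are then instances of the modular law. Given this equality, the groups
`G_{c,i}` and `G_{c,∞}` restrict to `H` because an automorphism that extends an element of `H` fixes
`M`. For `G_{i,i}` the point is that one and the same auxiliary extension `l'` serves for both base
fields (`isStandard_and_hasRamificationIndexOne_iff`): the constants of `l'M_c` lie in
`C ∩ l'L ⊆ A ∩ l'L = l'K_c`, so `l'M_c` and `l'K_c` have the same constant subfield. Existence of
admissible extensions uses in addition that `L ∩ A`, being finite over `K`, lies in the compositum
of `C` and a finite subextension of `U`.

For the first fact, `U` is generated by the Hensel roots, the elements that are simple roots modulo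
the maximal ideal of integral polynomials. A Galois argument takes the place of Hensel's lemma: the
valuation is invariant under automorphisms, so an automorphism over a field `F` that contains the
residue of a Hensel root fixes this root (`IsHenselRoot.mem_of_residue_mem`). That every unramified
extension is generated by Hensel roots is the absence of defect, by completeness and discreteness.

That `k₀(E)` is algebraic over `k₀(K)` (`exists_isFiniteExt_constantBase`) comes from the residue
fields: with `F_E = ⋂ Ē ^ (p ^ n)`, the extension `F_E / F_K` is finite (`IsFiniteExt.perfectCore`).
Lifting generators to roots of monic polynomials over `k₀(K)` gives a finite, hence complete,
extension `Q` of `k₀(K)` whose residue field contains `F_E`. By existence of Teichmüller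
representatives in `Q` and their uniqueness in `EQ`, those of `E` lie in `Q`.
-/

noncomputable section

namespace LowerRamification

/-! ### Subfields of an algebraically closed field and their automorphisms -/

section FieldTheory

open Polynomial

variable {Ω : Type*} [Field Ω]

theorem isAlgebraic_of_le {E F : Subfield Ω} (h : E ≤ F) {x : Ω} (hx : IsAlgebraic E x) :
    IsAlgebraic F x := by
  let _ := (Subfield.inclusion h).toAlgebra
  have : IsScalarTower E F Ω := IsScalarTower.of_algebraMap_eq fun _ => rfl
  exact hx.tower_top F

theorem isAlgebraic_trans {E F : Subfield Ω} (h : ∀ y ∈ F, IsAlgebraic E y) {x : Ω}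
    (hx : IsAlgebraic F x) : IsAlgebraic E x := by
  have hx' : IsAlgebraic (algebraicClosure E Ω) x :=
    isAlgebraic_of_le (F := (algebraicClosure E Ω).toSubfield)
      (fun y hy => mem_algebraicClosure_iff.2 (h y hy)) hx
  exact IsAlgebraic.restrictScalars E hx'

theorem isSeparable_of_le {E F : Subfield Ω} (h : E ≤ F) {x : Ω} (hx : IsSeparable E x) :
    IsSeparable F x := by
  let _ := (Subfield.inclusion h).toAlgebra
  have : IsScalarTower E F Ω := IsScalarTower.of_algebraMap_eq fun _ => rfl
  exact hx.tower_top F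

theorem isSeparable_of_mem_closure {E : Subfield Ω} {S : Set Ω} (hS : ∀ x ∈ S, IsSeparable E x)
    {x : Ω} (hx : x ∈ E ⊔ Subfield.closure S) : IsSeparable E x := by
  have : E ⊔ Subfield.closure S ≤ (separableClosure E Ω).toSubfield :=
    sup_le (fun y hy => (separableClosure E Ω).algebraMap_mem ⟨y, hy⟩)
      (Subfield.closure_le.2 fun y hy => mem_separableClosure_iff.2 (hS y hy))
  exact mem_separableClosure_iff.1 (this hx)

theorem adjoin_toSubfield_eq (E : Subfield Ω) (S : Set Ω) :
    (IntermediateField.adjoin E S).toSubfield = E ⊔ Subfield.closure S := by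
  rw [IntermediateField.adjoin_toSubfield, Subfield.closure_union]
  congr 1
  have : Set.range (algebraMap E Ω) = (E : Set Ω) := Subtype.range_coe
  rw [this, Subfield.closure_eq]

theorem mem_sup_closure {G : Subfield Ω} {S : Set Ω} {x : Ω} (hx : x ∈ S) :
    x ∈ G ⊔ Subfield.closure S :=
  (le_sup_right : _ ≤ G ⊔ _) (Subfield.subset_closure hx)

theorem exists_finset_of_mem_sup_closure {G : Subfield Ω} {S : Set Ω} {x : Ω}
    (hx : x ∈ G ⊔ Subfield.closure S) :
    ∃ T : Finset Ω, (T : Set Ω) ⊆ S ∧ x ∈ G ⊔ Subfield.closure (T : Set Ω) := by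
  rw [← adjoin_toSubfield_eq] at hx
  obtain ⟨T, hT, hx⟩ := IntermediateField.exists_finset_of_mem_adjoin hx
  refine ⟨T, hT, ?_⟩
  rw [← adjoin_toSubfield_eq]
  exact hx

theorem isFiniteExt_iff {E F : Subfield Ω} : IsFiniteExt E F ↔
    ∃ N : IntermediateField E Ω, FiniteDimensional E N ∧ N.toSubfield = F := by
  constructor
  · rintro ⟨h, hr⟩
    rw [Subfield.relfinrank_eq_finrank_of_le h] at hr
    exact ⟨Subfield.extendScalars h, Module.finite_of_finrank_pos (Nat.pos_of_ne_zero hr), rfl⟩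
  · rintro ⟨N, hN, rfl⟩
    have h : E ≤ N.toSubfield := fun y hy => N.algebraMap_mem ⟨y, hy⟩
    refine ⟨h, ?_⟩
    rw [Subfield.relfinrank_eq_finrank_of_le h]
    exact (Module.finrank_pos (R := E) (M := N)).ne'

theorem isFiniteExt_sup_closure {E : Subfield Ω} {S : Set Ω} (hS : S.Finite)
    (h : ∀ x ∈ S, IsAlgebraic E x) : IsFiniteExt E (E ⊔ Subfield.closure S) := by
  have := hS.to_subtype
  exact isFiniteExt_iff.2 ⟨IntermediateField.adjoin E S,
    IntermediateField.finiteDimensional_adjoin fun x hx => (h x hx).isIntegral,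
    adjoin_toSubfield_eq E S⟩

theorem IsFiniteExt.exists_finset {E F : Subfield Ω} (h : IsFiniteExt E F) :
    ∃ T : Finset Ω, (∀ x ∈ T, IsAlgebraic E x) ∧ F = E ⊔ Subfield.closure (T : Set Ω) := by
  obtain ⟨N, hN, rfl⟩ := isFiniteExt_iff.1 h
  obtain ⟨T, hT⟩ := N.fg_of_fg_toSubalgebra (Subalgebra.fg_of_fg_toSubmodule
    ((Submodule.fg_iff_finiteDimensional (Subalgebra.toSubmodule N.toSubalgebra)).2 hN))
  refine ⟨T, fun x hx => ?_, by rw [← adjoin_toSubfield_eq, hT]⟩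
  have hxN : x ∈ N := hT ▸ IntermediateField.subset_adjoin E _ hx
  exact IntermediateField.isAlgebraic_iff.1 (Algebra.IsAlgebraic.isAlgebraic (⟨x, hxN⟩ : N))

theorem IsFiniteExt.isAlgebraic {E F : Subfield Ω} (h : IsFiniteExt E F) {x : Ω} (hx : x ∈ F) :
    IsAlgebraic E x := by
  obtain ⟨N, hN, rfl⟩ := isFiniteExt_iff.1 h
  exact IntermediateField.isAlgebraic_iff.1 (Algebra.IsAlgebraic.isAlgebraic (⟨x, hx⟩ : N))

theorem IsFiniteExt.trans {E F G : Subfield Ω} (h : IsFiniteExt E F) (h' : IsFiniteExt F G) :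
    IsFiniteExt E G := by
  refine ⟨h.1.trans h'.1, ?_⟩
  rw [← Subfield.relfinrank_mul_relfinrank h.1 h'.1]
  exact mul_ne_zero h.2 h'.2

theorem IsFiniteExt.left {E F G : Subfield Ω} (h : IsFiniteExt E G) (h1 : E ≤ F) (h2 : F ≤ G) :
    IsFiniteExt E F := by
  refine ⟨h1, fun h0 => h.2 ?_⟩
  rw [← Subfield.relfinrank_mul_relfinrank h1 h2, h0, zero_mul]

theorem IsFiniteExt.refl (E : Subfield Ω) : IsFiniteExt E E :=
  ⟨le_rfl, by simp⟩

theorem IsFiniteExt.sup_left {E F G : Subfield Ω} (h : IsFiniteExt E F) (hG : E ≤ G) :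
    IsFiniteExt G (G ⊔ F) := by
  obtain ⟨T, hT, rfl⟩ := h.exists_finset
  rw [← sup_assoc, sup_eq_left.2 hG]
  exact isFiniteExt_sup_closure T.finite_toSet fun x hx => isAlgebraic_of_le hG (hT x hx)

theorem IsFiniteExt.sup {E F G : Subfield Ω} (h : IsFiniteExt E F) (h' : IsFiniteExt E G) :
    IsFiniteExt E (F ⊔ G) :=
  h.trans (h'.sup_left h.1)

/-- Two automorphisms agreeing on a set of generators agree on the compositum. -/
theorem eq_of_mem_sup_closure {E : Subfield Ω} {S : Set Ω} {σ τ : Ω ≃+* Ω}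
    (hE : ∀ x ∈ E, σ x = τ x) (hS : ∀ x ∈ S, σ x = τ x) {x : Ω}
    (hx : x ∈ E ⊔ Subfield.closure S) : σ x = τ x := by
  have : E ⊔ Subfield.closure S ≤ (σ : Ω →+* Ω).eqLocusField (τ : Ω →+* Ω) :=
    sup_le (fun y hy => hE y hy) (Subfield.closure_le.2 fun y hy => hS y hy)
  exact this hx

theorem eq_of_mem_sup {E F : Subfield Ω} {σ τ : Ω ≃+* Ω}
    (hE : ∀ x ∈ E, σ x = τ x) (hF : ∀ x ∈ F, σ x = τ x) {x : Ω} (hx : x ∈ E ⊔ F) :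
    σ x = τ x := by
  have : E ⊔ F ≤ (σ : Ω →+* Ω).eqLocusField (τ : Ω →+* Ω) :=
    sup_le (fun y hy => hE y hy) (fun y hy => hF y hy)
  exact this hx

theorem exists_primitive_element_of_separable {k : Subfield Ω} {T : Finset Ω}
    (hT : ∀ x ∈ T, IsSeparable k x) : ∃ θ : Ω, IsSeparable k θ ∧
      k ⊔ Subfield.closure {θ} = k ⊔ Subfield.closure (T : Set Ω) := by
  have hfd : FiniteDimensional k (IntermediateField.adjoin k (T : Set Ω)) :=
    IntermediateField.finiteDimensional_adjoin fun z hz => (hT z hz).isIntegral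
  have hsep : Algebra.IsSeparable k (IntermediateField.adjoin k (T : Set Ω)) :=
    (IntermediateField.isSeparable_adjoin_iff_isSeparable _ _).2 fun z hz => hT z hz
  obtain ⟨θ, hθ⟩ := Field.exists_primitive_element k (IntermediateField.adjoin k (T : Set Ω))
  have hθ' : IntermediateField.adjoin k {(θ : Ω)} = IntermediateField.adjoin k (T : Set Ω) := by
    rw [← IntermediateField.lift_adjoin_simple, hθ, IntermediateField.lift_top]
  have hclos : k ⊔ Subfield.closure {(θ : Ω)} = k ⊔ Subfield.closure (T : Set Ω) := by
    rw [← adjoin_toSubfield_eq, hθ', adjoin_toSubfield_eq]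
  refine ⟨θ, isSeparable_of_mem_closure (fun z hz => hT z hz) ?_, hclos⟩
  rw [← hclos]
  exact mem_sup_closure rfl

theorem exists_isSeparable_pow {k : Subfield Ω} (q : ℕ) [ExpChar k q] {x : Ω}
    (hx : IsAlgebraic k x) : ∃ n, IsSeparable k (x ^ q ^ n) := by
  obtain ⟨g, hg, n, hn⟩ := (minpoly.irreducible hx.isIntegral).hasSeparableContraction q
  refine ⟨n, ?_⟩
  have h0 : aeval (x ^ q ^ n) g = 0 := by
    rw [← expand_aeval, hn, minpoly.aeval]
  exact hg.of_dvd (minpoly.dvd k _ h0)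

theorem mem_of_isSeparable_of_pow_mem {k : Subfield Ω} (q : ℕ) [ExpChar k q] {x : Ω}
    (hx : IsSeparable k x) {n : ℕ} (hn : x ^ q ^ n ∈ k) : x ∈ k := by
  have h1 : (minpoly k x).natSepDegree = 1 :=
    (minpoly.natSepDegree_eq_one_iff_pow_mem q).2 ⟨n, ⟨x ^ q ^ n, hn⟩, rfl⟩
  rw [Separable.natSepDegree_eq_natDegree hx] at h1
  obtain ⟨y, rfl⟩ := minpoly.mem_range_of_degree_eq_one k x
    ((degree_eq_iff_natDegree_eq_of_pos one_pos).2 h1)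
  exact y.2

variable [IsAlgClosed Ω]

theorem exists_ringEquiv_of_root {F : Subfield Ω} (hF : ∀ x : Ω, IsAlgebraic F x) {x y : Ω}
    (hy : aeval y (minpoly F x) = 0) : ∃ σ : Ω ≃+* Ω, (∀ z ∈ F, σ z = z) ∧ σ x = y := by
  have : Algebra.IsAlgebraic F Ω := ⟨hF⟩
  have : IsAlgClosure F Ω := ⟨inferInstance, inferInstance⟩
  have : Normal F Ω := IsAlgClosure.normal F Ω
  obtain ⟨σ, hσ⟩ := minpoly.exists_algEquiv_of_root' (L := Ω) (hF x) hy
  exact ⟨σ.toRingEquiv, fun z hz => σ.commutes ⟨z, hz⟩, hσ⟩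

/-- A separable element fixed by all automorphisms over `F` lies in `F`. -/
theorem mem_of_forall_fixed {F : Subfield Ω} (hF : ∀ x : Ω, IsAlgebraic F x) {x : Ω}
    (hx : IsSeparable F x) (h : ∀ σ : Ω ≃+* Ω, (∀ z ∈ F, σ z = z) → σ x = x) : x ∈ F := by
  have h1 : (minpoly F x).natDegree = 1 := by
    have hs : ((minpoly F x).map (algebraMap F Ω)).Separable :=
      Polynomial.Separable.map hx
    have hsp : ((minpoly F x).map (algebraMap F Ω)).Splits := IsAlgClosed.splits _
    have hroots : ((minpoly F x).map (algebraMap F Ω)).roots ≤ {x} := by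
      rw [Multiset.le_iff_subset (nodup_roots hs)]
      intro y hy
      have hy' : aeval y (minpoly F x) = 0 := by
        rw [mem_roots hs.ne_zero, IsRoot, eval_map_algebraMap] at hy
        exact hy
      obtain ⟨σ, hσ, rfl⟩ := exists_ringEquiv_of_root hF hy'
      simp [h σ hσ]
    have hc := Multiset.card_le_card hroots
    rw [← hsp.natDegree_eq_card_roots, natDegree_map] at hc
    have := minpoly.natDegree_pos (hF x).isIntegral
    simp at hc
    omega
  have := minpoly.mem_range_of_degree_eq_one F x
    ((degree_eq_iff_natDegree_eq_of_pos one_pos).2 h1)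
  obtain ⟨y, rfl⟩ := this
  exact y.2

/-- If all conjugates of `θ` over `A` lie in `N`, an automorphism fixing `N ∩ A` agrees at `θ` with
one that fixes `A`. -/
theorem exists_ringEquiv_agree {A N : Subfield Ω} (hA : ∀ x : Ω, IsAlgebraic A x) {θ : Ω}
    (hN : ∀ y, aeval y (minpoly A θ) = 0 → y ∈ N) {σ : Ω ≃+* Ω} (hσ : ∀ x ∈ N ⊓ A, σ x = x) :
    ∃ τ : Ω ≃+* Ω, (∀ z ∈ A, τ z = z) ∧ τ θ = σ θ := by
  have hm : (minpoly A θ).Monic := minpoly.monic (hA θ).isIntegral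
  have hsp : ((minpoly A θ).map (algebraMap A Ω)).Splits := IsAlgClosed.splits _
  have hroot : ∀ y ∈ ((minpoly A θ).map (algebraMap A Ω)).roots, y ∈ N := by
    intro y hy
    rw [mem_roots (hm.map _).ne_zero, IsRoot, eval_map_algebraMap] at hy
    exact hN y hy
  have hcoeff : ∀ n, (((minpoly A θ).coeff n : A) : Ω) ∈ N := by
    intro n
    have h1 : (((minpoly A θ).coeff n : A) : Ω) =
        ((minpoly A θ).map (algebraMap A Ω)).coeff n := by
      rw [coeff_map]; rfl
    rw [h1, hsp.eq_prod_roots_of_monic (hm.map _)]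
    have h2 : ((((minpoly A θ).map (algebraMap A Ω)).roots.map fun a => X - C a).prod) ∈
        lifts (algebraMap N Ω) := by
      refine multiset_prod_mem _ fun q hq => ?_
      obtain ⟨a, ha, rfl⟩ := Multiset.mem_map.1 hq
      refine (mem_lifts _).2 ⟨X - C ⟨a, hroot a ha⟩, ?_⟩
      rw [Polynomial.map_sub, map_X, map_C]
      rfl
    obtain ⟨y, hy⟩ := (lifts_iff_coeff_lifts _).1 h2 n
    rw [← hy]
    exact y.2
  have : aeval (σ θ) (minpoly A θ) = 0 := by
    have h0 : (σ : Ω →+* Ω) (aeval θ (minpoly A θ)) = 0 := by rw [minpoly.aeval]; simp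
    rw [aeval_def, hom_eval₂] at h0
    rw [aeval_def, eval₂_eq_sum, ← h0, eval₂_eq_sum]
    refine Finset.sum_congr rfl fun n _ => ?_
    refine congrArg (· * σ θ ^ n) ?_
    exact (hσ _ ⟨hcoeff n, ((minpoly A θ).coeff n).2⟩).symm
  obtain ⟨τ, h1, h2⟩ := exists_ringEquiv_of_root hA this
  exact ⟨τ, h1, h2⟩

/-- Modular law for a finite Galois extension `L = k(θ)` of `k`: it is the translation of the fact
that `Gal(LA/A)` restricts isomorphically onto `Gal(L/L ∩ A)`. -/
theorem mem_of_mem_sup_of_galois {k L E M A : Subfield Ω} (hk : ∀ x : Ω, IsAlgebraic k x) {θ : Ω}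
    (hθ : IsSeparable k θ) (hL : L = k ⊔ Subfield.closure {θ})
    (hnorm : ∀ y, aeval y (minpoly k θ) = 0 → y ∈ L) (hkE : k ≤ E) (hEA : E ≤ A)
    (hML : M ≤ L) {x : Ω}
    (hxL : x ∈ E ⊔ L) (hxA : x ∈ M ⊔ A) : x ∈ E ⊔ M ⊔ (L ⊓ A) := by
  have hkF : k ≤ E ⊔ M ⊔ (L ⊓ A) := hkE.trans (le_sup_left.trans le_sup_left)
  have hxE : x ∈ E ⊔ Subfield.closure {θ} := by
    rwa [hL, ← sup_assoc, sup_eq_left.2 hkE] at hxL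
  refine mem_of_forall_fixed (fun z => isAlgebraic_of_le hkF (hk z)) ?_ fun σ hσ => ?_
  · refine isSeparable_of_le (le_sup_left.trans le_sup_left) (isSeparable_of_mem_closure ?_ hxE)
    rintro _ rfl
    exact isSeparable_of_le hkE hθ
  · have hkA := hkE.trans hEA
    have hroots : ∀ y, aeval y (minpoly A θ) = 0 → y ∈ L := by
      intro y hy
      refine hnorm y ?_
      let _ := (Subfield.inclusion hkA).toAlgebra
      have : IsScalarTower k A Ω := IsScalarTower.of_algebraMap_eq fun _ => rfl
      have hdvd := minpoly.dvd_map_of_isScalarTower k A θ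
      have := aeval_eq_zero_of_dvd_aeval_eq_zero hdvd hy
      rwa [aeval_map_algebraMap] at this
    obtain ⟨τ, hτ, hτθ⟩ := exists_ringEquiv_agree (A := A) (N := L) (θ := θ) (σ := σ)
      (fun z => isAlgebraic_of_le hkA (hk z)) hroots
      (fun z hz => hσ z ((le_sup_right : L ⊓ A ≤ _) hz))
    have hE : ∀ z ∈ E, σ z = τ z := fun z hz => by
      rw [hτ z (hEA hz), hσ z ((le_sup_left.trans le_sup_left : E ≤ _) hz)]
    have hL' : ∀ z ∈ E ⊔ L, σ z = τ z := fun z hz => by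
      refine eq_of_mem_sup_closure (E := E) (S := {θ}) hE (by rintro _ rfl; exact hτθ.symm) ?_
      rwa [hL, ← sup_assoc, sup_eq_left.2 hkE] at hz
    have hA : ∀ z ∈ M ⊔ A, τ z = RingEquiv.refl Ω z := fun z hz => by
      refine eq_of_mem_sup (fun w hw => ?_) hτ hz
      rw [← hL' w ((le_sup_right : L ≤ _) (hML hw))]
      exact hσ w ((le_sup_right.trans le_sup_left : M ≤ _) hw)
    rw [hL' x hxL]
    exact hA x hxA

/-- Modular law for the compositum `CE` of a field `E ⊇ k` with the algebraic closure `C` of `k`: an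
element of `CE` that is separable over `E` lies in `(X ∩ C)E` for every `X ⊇ E` containing it. -/
theorem mem_of_mem_sup_of_separable {k C E X : Subfield Ω} (hE : ∀ x : Ω, IsAlgebraic E x)
    (hC : ∀ x : Ω, x ∈ C ↔ IsAlgebraic k x) (hkE : k ≤ E) (hEX : E ≤ X) {x : Ω}
    (hxX : x ∈ X) (hxC : x ∈ C ⊔ E) (hx : IsSeparable E x) : x ∈ (X ⊓ C) ⊔ E := by
  -- `x` is already in the compositum of `E` and the separable closure of `k`
  have hx1 : x ∈ E ⊔ Subfield.closure {c | IsSeparable k c} := by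
    refine mem_of_forall_fixed (fun z => isAlgebraic_of_le le_sup_left (hE z))
      (isSeparable_of_le le_sup_left hx) fun σ hσ => ?_
    refine eq_of_mem_sup (σ := σ) (τ := RingEquiv.refl Ω) (fun c hc => ?_)
      (fun z hz => hσ z ((le_sup_left : E ≤ _) hz)) hxC
    obtain ⟨q, hq⟩ := ExpChar.exists k
    have : ExpChar Ω q := expChar_of_injective_algebraMap (algebraMap k Ω).injective q
    obtain ⟨n, hn⟩ := exists_isSeparable_pow q ((hC c).1 hc)
    have h1 := hσ (c ^ q ^ n) (mem_sup_closure hn)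
    rw [map_pow] at h1
    exact iterateFrobenius_inj Ω q n h1
  obtain ⟨T, hT, hxT⟩ := exists_finset_of_mem_sup_closure hx1
  obtain ⟨θ, hθs, hclos⟩ := exists_primitive_element_of_separable fun z hz => hT hz
  have hEclos : E ⊔ Subfield.closure {θ} = E ⊔ Subfield.closure (T : Set Ω) := by
    rw [← sup_eq_left.2 hkE, sup_assoc, hclos, sup_assoc]
  rw [← hEclos] at hxT
  have hθk : IsAlgebraic k θ := hθs.isIntegral.isAlgebraic
  refine mem_of_forall_fixed (fun z => isAlgebraic_of_le le_sup_right (hE z))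
    (isSeparable_of_le le_sup_right hx) fun σ hσ => ?_
  have hkX := hkE.trans hEX
  have hroots : ∀ y, aeval y (minpoly X θ) = 0 → y ∈ C := by
    intro y hy
    let _ := (Subfield.inclusion hkX).toAlgebra
    have : IsScalarTower k X Ω := IsScalarTower.of_algebraMap_eq fun _ => rfl
    have h1 := aeval_eq_zero_of_dvd_aeval_eq_zero
      (minpoly.dvd_map_of_isScalarTower k X θ) hy
    rw [aeval_map_algebraMap] at h1
    exact (hC y).2 ⟨_, minpoly.ne_zero hθk.isIntegral, h1⟩
  obtain ⟨τ, hτ, hτθ⟩ := exists_ringEquiv_agree (A := X) (N := C) (σ := σ)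
    (fun z => isAlgebraic_of_le hEX (hE z)) hroots
    (fun z hz => hσ z ((le_sup_left : X ⊓ C ≤ _) ⟨hz.2, hz.1⟩))
  have h1 : σ x = τ x := eq_of_mem_sup_closure (E := E) (S := {θ})
    (fun z hz => by rw [hσ z ((le_sup_right : E ≤ _) hz), hτ z (hEX hz)])
    (by rintro _ rfl; exact hτθ.symm) hxT
  rw [h1, hτ x hxX]

end FieldTheory

section Valued

variable {Ω : Type*} [Field Ω] (v : Valuation Ω ℝ≥0)

open IsLocalRing Filter Topology

/-! ### Residues -/

variable {v}

theorem residue_eq_iff {x y : v.valuationSubring} :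
    residue v.valuationSubring x = residue v.valuationSubring y ↔ v ((x : Ω) - y) < 1 := by
  rw [← sub_eq_zero, ← map_sub, residue_eq_zero_iff, Valuation.mem_maximalIdeal_iff]
  rfl

theorem residue_eq_zero_iff_lt {x : v.valuationSubring} :
    residue v.valuationSubring x = 0 ↔ v (x : Ω) < 1 := by
  have := residue_eq_iff (x := x) (y := 0)
  simpa using this

theorem mem_residueSubfield {E : Subfield Ω} {a : ResidueField v.valuationSubring} :
    a ∈ residueSubfield v E ↔
      ∃ x : v.valuationSubring, (x : Ω) ∈ E ∧ residue v.valuationSubring x = a :=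
  Iff.rfl

theorem residueSubfield_mono {E F : Subfield Ω} (h : E ≤ F) :
    residueSubfield v E ≤ residueSubfield v F := by
  rintro _ ⟨x, hx, rfl⟩
  exact ⟨x, h hx, rfl⟩

/-- If the residues of the integers `x i` are linearly independent over the residue field of `F`,
then the `x i` are orthogonal over `F`. -/
theorem le_valuation_sum_of_linearIndependent {ι : Type*} [Fintype ι] {F : Subfield Ω}
    {x : ι → v.valuationSubring}
    (hx : LinearIndependent (residueSubfield v F) fun i => residue v.valuationSubring (x i))
    {c : ι → Ω} (hc : ∀ i, c i ∈ F) (i : ι) : v (c i) ≤ v (∑ j, c j * x j) := by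
  obtain ⟨m, -, hm⟩ := Finset.exists_max_image Finset.univ (fun j => v (c j)) ⟨i, Finset.mem_univ i⟩
  refine (hm i (Finset.mem_univ i)).trans ?_
  by_contra! hlt
  have h0 : c m ≠ 0 := by
    intro h
    rw [h, map_zero] at hlt
    exact not_lt_zero hlt
  have hv0 : v (c m) ≠ 0 := (Valuation.ne_zero_iff v).2 h0
  have hd : ∀ j, v (c j / c m) ≤ 1 := fun j => by
    rw [map_div₀]
    exact div_le_one_of_le₀ (hm j (Finset.mem_univ j)) zero_le
  let d : ι → v.valuationSubring := fun j => ⟨c j / c m, hd j⟩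
  have hsum : residue v.valuationSubring (∑ j, d j * x j) = 0 := by
    rw [residue_eq_zero_iff_lt]
    have h1 : ((∑ j, d j * x j : v.valuationSubring) : Ω) = (∑ j, c j * x j) / c m := by
      push_cast
      rw [Finset.sum_div]
      exact Finset.sum_congr rfl fun j _ => by simp only [d]; ring
    rw [h1, map_div₀]
    exact (div_lt_one₀ (pos_iff_ne_zero.2 hv0)).2 hlt
  rw [Fintype.linearIndependent_iff] at hx
  have := hx (fun j => ⟨residue _ (d j), d j, div_mem (hc j) (hc m), rfl⟩) (by
    rw [map_sum] at hsum
    simp only [map_mul] at hsum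
    exact hsum) m
  have h1 : residue v.valuationSubring (d m) = 0 := congrArg Subtype.val this
  rw [residue_eq_zero_iff_lt] at h1
  simp only [d, div_self h0, map_one] at h1
  exact lt_irrefl _ h1

theorem linearIndependent_of_residue {ι : Type*} [Fintype ι] {F : Subfield Ω}
    {x : ι → v.valuationSubring}
    (hx : LinearIndependent (residueSubfield v F) fun i => residue v.valuationSubring (x i)) :
    LinearIndependent F fun i => (x i : Ω) := by
  rw [Fintype.linearIndependent_iff]
  intro g hg i
  have := le_valuation_sum_of_linearIndependent hx (c := fun i => (g i : Ω)) (fun i => (g i).2) i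
  have h0 : ∑ j, (g j : Ω) * (x j : Ω) = 0 := hg
  rw [h0, map_zero, nonpos_iff_eq_zero, map_eq_zero] at this
  exact Subtype.ext this

/-- The residue extension of a finite extension is finite. -/
theorem IsFiniteExt.residueSubfield {E F : Subfield Ω} (h : IsFiniteExt E F) :
    IsFiniteExt (residueSubfield v E) (residueSubfield v F) := by
  obtain ⟨N, hN, rfl⟩ := isFiniteExt_iff.1 h
  have hle := residueSubfield_mono (v := v) h.1
  refine isFiniteExt_iff.2 ⟨Subfield.extendScalars hle, ?_, rfl⟩
  have hr : Module.rank (LowerRamification.residueSubfield v E) (Subfield.extendScalars hle) ≤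
      Module.finrank E N := by
    refine rank_le fun s hs => ?_
    have hmem : ∀ a : s, ∃ x : v.valuationSubring, (x : Ω) ∈ N ∧
        residue v.valuationSubring x = (a : Subfield.extendScalars hle) := fun a => a.1.2
    choose x hxN hx using hmem
    have h1 : LinearIndependent (LowerRamification.residueSubfield v E)
        fun a : s => residue v.valuationSubring (x a) := by
      simp only [hx]
      exact hs.map' (Subfield.extendScalars hle).val.toLinearMap (LinearMap.ker_eq_bot.2
        (Subfield.extendScalars hle).val.injective)
    have h2 : LinearIndependent E fun a : s => (⟨x a, hxN a⟩ : N) :=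
      LinearIndependent.of_comp N.val.toLinearMap (linearIndependent_of_residue h1)
    simpa using h2.fintype_card_le_finrank
  exact Module.rank_lt_aleph0_iff.1 (hr.trans_lt Cardinal.natCast_lt_aleph0)

/-! ### Completeness -/

/-- Completeness, in terms of sequences with consecutive terms getting closer (as the valuation is
nonarchimedean, these are the Cauchy sequences). -/
def IsSeqComplete (v : Valuation Ω ℝ≥0) (S : Set Ω) : Prop :=
  ∀ s : ℕ → Ω, (∀ n, s n ∈ S) → Tendsto (fun n => v (s (n + 1) - s n)) atTop (𝓝 0) →
    ∃ x ∈ S, Tendsto (fun n => v (x - s n)) atTop (𝓝 0)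

/-- `x` is a limit of elements of `S`. -/
def IsLimitOf (v : Valuation Ω ℝ≥0) (S : Set Ω) (x : Ω) : Prop :=
  ∀ ε : ℝ≥0, 0 < ε → ∃ y ∈ S, v (x - y) < ε

theorem eq_zero_of_tendsto {x y : Ω} {s : ℕ → Ω} (hx : Tendsto (fun n => v (x - s n)) atTop (𝓝 0))
    (hy : Tendsto (fun n => v (y - s n)) atTop (𝓝 0)) : x = y := by
  have h := hx.max hy
  rw [max_self] at h
  have h2 : v (x - y) ≤ 0 := ge_of_tendsto' h fun n => by
    have : x - y = (x - s n) - (y - s n) := by ring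
    rw [this]
    exact Valuation.map_sub v _ _
  exact sub_eq_zero.1 ((map_eq_zero v).1 (le_antisymm h2 zero_le))

theorem tendsto_sub_succ {x : Ω} {s : ℕ → Ω} (hx : Tendsto (fun n => v (x - s n)) atTop (𝓝 0)) :
    Tendsto (fun n => v (s (n + 1) - s n)) atTop (𝓝 0) := by
  have h := hx.max ((tendsto_add_atTop_iff_nat 1).2 hx)
  rw [max_self] at h
  refine tendsto_of_tendsto_of_tendsto_of_le_of_le tendsto_const_nhds h (fun _ => zero_le)
    fun n => ?_
  have : s (n + 1) - s n = (x - s n) - (x - s (n + 1)) := by ring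
  simp only [this]
  exact Valuation.map_sub v _ _

theorem IsLimitOf.exists_seq {S : Set Ω} {x : Ω} (h : IsLimitOf v S x) :
    ∃ s : ℕ → Ω, (∀ n, s n ∈ S) ∧ Tendsto (fun n => v (x - s n)) atTop (𝓝 0) := by
  choose s hs hlt using fun n : ℕ => h (1 / ((n : ℝ≥0) + 1)) (by positivity)
  exact ⟨s, hs, tendsto_of_tendsto_of_tendsto_of_le_of_le tendsto_const_nhds
    tendsto_one_div_add_atTop_nhds_zero_nat (fun _ => zero_le) fun n => (hlt n).le⟩

theorem IsSeqComplete.mem_of_isLimitOf {S : Set Ω} (hS : IsSeqComplete v S) {x : Ω}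
    (h : IsLimitOf v S x) : x ∈ S := by
  obtain ⟨s, hs, hx⟩ := h.exists_seq
  obtain ⟨y, hy, hy'⟩ := hS s hs (tendsto_sub_succ hx)
  rwa [eq_zero_of_tendsto hx hy']

theorem isLimitOf_of_tendsto {S : Set Ω} {x : Ω} {s : ℕ → Ω} (hs : ∀ n, s n ∈ S)
    (hx : Tendsto (fun n => v (x - s n)) atTop (𝓝 0)) : IsLimitOf v S x := fun ε hε => by
  obtain ⟨n, hn⟩ := (hx.eventually_lt_const hε).exists
  exact ⟨s n, hs n, hn⟩

theorem IsSeqComplete.of_closed {S T : Set Ω} (hT : IsSeqComplete v T) (hST : S ⊆ T)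
    (hS : ∀ x, IsLimitOf v S x → x ∈ S) : IsSeqComplete v S := fun s hs hc => by
  obtain ⟨x, -, hx⟩ := hT s (fun n => hST (hs n)) hc
  exact ⟨x, hS x (isLimitOf_of_tendsto hs hx), hx⟩

theorem IsSeqComplete.span_insert {F : Subfield Ω} (hF : IsSeqComplete v (F : Set Ω))
    {W : Submodule F Ω} (hW : IsSeqComplete v (W : Set Ω)) (x : Ω) :
    IsSeqComplete v ((Submodule.span F {x} ⊔ W : Submodule F Ω) : Set Ω) := by
  by_cases hx : x ∈ W
  · rwa [sup_eq_right.2 ((Submodule.span_singleton_le_iff_mem _ _).2 hx)]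
  obtain ⟨δ, hδ, hd⟩ : ∃ δ : ℝ≥0, 0 < δ ∧ ∀ w ∈ W, δ ≤ v (x - w) := by
    by_contra! h
    exact hx (hW.mem_of_isLimitOf fun ε hε => by simpa using h ε hε)
  -- a vector `c x + w` is at least as large as `c`, up to the factor `δ`
  have key : ∀ c ∈ F, ∀ w ∈ W, v c * δ ≤ v (c * x + w) := by
    intro c hc w hw
    by_cases h0 : c = 0
    · simp [h0]
    have h1 : c * x + w = c * (x - (-c⁻¹ * w)) := by field_simp; ring
    rw [h1, map_mul]
    gcongr
    exact hd _ (W.smul_mem ⟨-c⁻¹, neg_mem (inv_mem hc)⟩ hw)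
  intro s hs hc
  have hmem : ∀ n, ∃ c ∈ F, ∃ w ∈ W, s n = c * x + w := fun n => by
    obtain ⟨y, hy, w, hw, h⟩ := Submodule.mem_sup.1 (hs n)
    obtain ⟨c, rfl⟩ := Submodule.mem_span_singleton.1 hy
    exact ⟨c, c.2, w, hw, h.symm⟩
  choose c hcF w hw hsn using hmem
  have hcc : Tendsto (fun n => v (c (n + 1) - c n)) atTop (𝓝 0) := by
    have h1 := hc.div_const δ
    rw [zero_div] at h1
    refine tendsto_of_tendsto_of_tendsto_of_le_of_le tendsto_const_nhds h1 (fun _ => zero_le)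
      fun n => ?_
    simp only
    rw [le_div_iff₀ hδ]
    refine (key _ (sub_mem (hcF (n + 1)) (hcF n)) _ (sub_mem (hw (n + 1)) (hw n))).trans_eq ?_
    rw [hsn, hsn]
    congr 1
    ring
  obtain ⟨a, ha, hac⟩ := hF c hcF hcc
  have hww : Tendsto (fun n => v (w (n + 1) - w n)) atTop (𝓝 0) := by
    have h1 := hc.max (hcc.mul_const (v x))
    rw [zero_mul, max_self] at h1
    refine tendsto_of_tendsto_of_tendsto_of_le_of_le tendsto_const_nhds h1 (fun _ => zero_le)
      fun n => ?_
    simp only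
    have h2 : w (n + 1) - w n = (s (n + 1) - s n) - (c (n + 1) - c n) * x := by
      rw [hsn, hsn]; ring
    rw [h2, ← map_mul]
    exact Valuation.map_sub v _ _
  obtain ⟨b, hb, hbw⟩ := hW w hw hww
  refine ⟨a * x + b, add_mem (Submodule.mem_sup_left
    (Submodule.mem_span_singleton.2 ⟨⟨a, ha⟩, rfl⟩)) (Submodule.mem_sup_right hb), ?_⟩
  have h1 := (hac.mul_const (v x)).max hbw
  rw [zero_mul, max_self] at h1
  refine tendsto_of_tendsto_of_tendsto_of_le_of_le tendsto_const_nhds h1 (fun _ => zero_le)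
    fun n => ?_
  simp only
  have h2 : a * x + b - s n = (a - c n) * x + (b - w n) := by rw [hsn]; ring
  rw [h2, ← map_mul]
  exact Valuation.map_add v _ _

/-- Finite extensions of complete fields are complete. -/
theorem IsSeqComplete.of_isFiniteExt {F Q : Subfield Ω} (hF : IsSeqComplete v (F : Set Ω))
    (h : IsFiniteExt F Q) : IsSeqComplete v (Q : Set Ω) := by
  obtain ⟨N, hN, rfl⟩ := isFiniteExt_iff.1 h
  have hfg : (Subalgebra.toSubmodule N.toSubalgebra).FG :=
    (Submodule.fg_iff_finiteDimensional _).2 hN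
  obtain ⟨T, hT⟩ := hfg
  have h1 : ∀ T : Finset Ω, IsSeqComplete v ((Submodule.span F (T : Set Ω)) : Set Ω) := by
    classical
    intro T
    induction T using Finset.induction_on with
    | empty =>
      intro s hs _
      have h0 : ∀ n, s n = 0 := fun n => by simpa using hs n
      exact ⟨0, by simp, by simp [h0]⟩
    | insert a T _ ih =>
      rw [Finset.coe_insert, Submodule.span_insert]
      exact hF.span_insert ih a
  have h2 := h1 T
  rw [hT] at h2
  exact h2

/-! ### Discreteness -/

/-- The values less than `1` of elements of `E` are bounded away from `1`. -/
def IsDiscreteSubfield (v : Valuation Ω ℝ≥0) (E : Subfield Ω) : Prop :=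
  ∃ c : ℝ≥0, c < 1 ∧ ∀ x ∈ E, v x < 1 → v x ≤ c

variable (v) in
/-- `k` is a complete discretely valued subfield of its algebraic closure `Ω`, and `v` is the
prolongation of its valuation. -/
structure IsCompleteDiscrete (k : Subfield Ω) : Prop where
  isAlgebraic : ∀ x : Ω, IsAlgebraic k x
  map_eq : ∀ σ : Ω ≃+* Ω, (∀ z ∈ k, σ z = z) → ∀ x, v (σ x) = v x
  complete : IsSeqComplete v (k : Set Ω)
  discrete : IsDiscreteSubfield v k
  nontrivial : ∃ π ∈ k, π ≠ 0 ∧ v π < 1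

open Polynomial in
theorem IsCompleteDiscrete.discrete_of_isFiniteExt [IsAlgClosed Ω] {k E : Subfield Ω}
    (hk : IsCompleteDiscrete v k) (h : IsFiniteExt k E) : IsDiscreteSubfield v E := by
  obtain ⟨N, hN, rfl⟩ := isFiniteExt_iff.1 h
  obtain ⟨c, hc, hd⟩ := hk.discrete
  set n := Module.finrank k N with hn
  have hn0 : n ≠ 0 := (Module.finrank_pos (R := k) (M := N)).ne'
  refine ⟨c ^ (1 / n : ℝ), NNReal.rpow_lt_one hc (by positivity), fun x hx hx1 => ?_⟩
  have hint := (hk.isAlgebraic x).isIntegral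
  have hdeg : (minpoly k x).natDegree ≤ n := by
    have := minpoly.natDegree_le (A := k) (⟨x, hx⟩ : N)
    rwa [← minpoly.algebraMap_eq (B' := Ω) (N.val.injective) (⟨x, hx⟩ : N)] at this
  -- the conjugates of `x` have the same value, so the constant coefficient is `v x ^ d`
  have hval : v (((minpoly k x).coeff 0 : k) : Ω) = v x ^ (minpoly k x).natDegree := by
    have hsp : ((minpoly k x).map (algebraMap k Ω)).Splits := IsAlgClosed.splits _
    have hm := (minpoly.monic hint).map (algebraMap k Ω)
    have h1 := hsp.coeff_zero_eq_prod_roots_of_monic hm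
    rw [coeff_map] at h1
    have h2 : v ((minpoly k x).map (algebraMap k Ω)).roots.prod =
        v x ^ ((minpoly k x).map (algebraMap k Ω)).roots.card := by
      rw [map_multiset_prod, Multiset.map_congr rfl (g := fun _ => v x), Multiset.map_const',
        Multiset.prod_replicate]
      intro y hy
      rw [mem_roots hm.ne_zero, IsRoot, eval_map_algebraMap] at hy
      obtain ⟨σ, hσ, rfl⟩ := exists_ringEquiv_of_root hk.isAlgebraic hy
      exact hk.map_eq σ hσ x
    rw [← hsp.natDegree_eq_card_roots, natDegree_map] at h2
    have h3 : (((minpoly k x).coeff 0 : k) : Ω) = algebraMap k Ω ((minpoly k x).coeff 0) := rfl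
    rw [h3, h1, map_mul, map_pow, Valuation.map_neg, map_one, one_pow, one_mul, h2]
  have hpos := minpoly.natDegree_pos hint
  have h1 : v x ^ (minpoly k x).natDegree ≤ c := by
    rw [← hval]
    refine hd _ ((minpoly k x).coeff 0).2 ?_
    rw [hval]
    exact pow_lt_one₀ zero_le hx1 hpos.ne'
  have h2 : v x ^ n ≤ c := (pow_le_pow_of_le_one zero_le hx1.le hdeg).trans h1
  rw [one_div]
  exact (NNReal.le_rpow_inv_iff (by positivity)).2 (by simpa using h2)

end Valued

/-! ### The maximal unramified extension -/

section Unramified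

variable {Ω : Type*} [Field Ω] {v : Valuation Ω ℝ≥0}

open IsLocalRing Polynomial Filter Topology

variable (v) in
/-- `x` is a simple root modulo the maximal ideal of a polynomial with integral coefficients
in `E`. -/
def IsHenselRoot (E : Subfield Ω) (x : v.valuationSubring) : Prop :=
  ∃ f : v.valuationSubring[X], (∀ n, (f.coeff n : Ω) ∈ E) ∧ f.eval x = 0 ∧
    residue v.valuationSubring (f.derivative.eval x) ≠ 0

variable (v) in
/-- The maximal unramified extension of `E`, generated by all the Hensel roots over `E`. -/
def unramifiedClosure (E : Subfield Ω) : Subfield Ω :=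
  E ⊔ Subfield.closure (Subtype.val '' {x : v.valuationSubring | IsHenselRoot v E x})

theorem le_unramifiedClosure (E : Subfield Ω) : E ≤ unramifiedClosure v E := le_sup_left

theorem IsHenselRoot.mem_unramifiedClosure {E : Subfield Ω} {x : v.valuationSubring}
    (hx : IsHenselRoot v E x) : (x : Ω) ∈ unramifiedClosure v E :=
  mem_sup_closure ⟨x, hx, rfl⟩

theorem IsHenselRoot.mono {E F : Subfield Ω} (h : E ≤ F) {x : v.valuationSubring}
    (hx : IsHenselRoot v E x) : IsHenselRoot v F x := by
  obtain ⟨f, hf, h1, h2⟩ := hx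
  exact ⟨f, fun n => h (hf n), h1, h2⟩

theorem unramifiedClosure_mono {E F : Subfield Ω} (h : E ≤ F) :
    unramifiedClosure v E ≤ unramifiedClosure v F :=
  sup_le_sup h (Subfield.closure_mono (Set.image_mono fun _ hx => hx.mono h))

theorem exists_map_eq_of_coeff_mem {A : Type*} [CommRing A] (φ : A →+* Ω) {E : Subfield Ω}
    {f : A[X]} (hf : ∀ n, φ (f.coeff n) ∈ E) : ∃ g : E[X], g.map (algebraMap E Ω) = f.map φ := by
  have : f.map φ ∈ lifts (algebraMap E Ω) := by
    rw [lifts_iff_coeff_lifts]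
    intro n
    rw [coeff_map]
    exact ⟨⟨_, hf n⟩, rfl⟩
  exact (mem_lifts _).1 this

theorem eval_map_subtype (f : v.valuationSubring[X]) (x : v.valuationSubring) :
    (f.map v.valuationSubring.subtype).eval (x : Ω) = (f.eval x : v.valuationSubring) := by
  rw [eval_map]
  exact eval₂_at_apply v.valuationSubring.subtype x

theorem eval_map_residue (f : v.valuationSubring[X]) (x : v.valuationSubring) :
    (f.map (residue v.valuationSubring)).eval (residue v.valuationSubring x) =
      residue v.valuationSubring (f.eval x) := by
  rw [eval_map]
  exact eval₂_at_apply _ x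

theorem isSeparable_of_simple_root {F κ : Type*} [Field F] [Field κ] [Algebra F κ] {g : F[X]}
    {x : κ} (h0 : aeval x g = 0) (h1 : aeval x g.derivative ≠ 0) : IsSeparable F x := by
  have hg : g ≠ 0 := by rintro rfl; simp at h1
  have halg : IsAlgebraic F x := ⟨g, hg, h0⟩
  rw [IsSeparable, separable_iff_derivative_ne_zero (minpoly.irreducible halg.isIntegral)]
  intro hd
  obtain ⟨q, rfl⟩ := minpoly.dvd F x h0
  rw [derivative_mul, hd] at h1
  simp at h1

theorem IsHenselRoot.isSeparable {E : Subfield Ω} {x : v.valuationSubring}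
    (hx : IsHenselRoot v E x) : IsSeparable E (x : Ω) := by
  obtain ⟨f, hf, h0, h1⟩ := hx
  obtain ⟨g, hg⟩ := exists_map_eq_of_coeff_mem v.valuationSubring.subtype hf
  refine isSeparable_of_simple_root (g := g) ?_ ?_
  · rw [← eval_map_algebraMap, hg, eval_map_subtype, h0]; rfl
  · rw [← eval_map_algebraMap, ← derivative_map, hg, derivative_map, eval_map_subtype]
    intro h
    exact h1 (by rw [show f.derivative.eval x = 0 from Subtype.ext h, map_zero])

theorem IsHenselRoot.isSeparable_residue {E : Subfield Ω} {x : v.valuationSubring}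
    (hx : IsHenselRoot v E x) :
    IsSeparable (residueSubfield v E) (residue v.valuationSubring x) := by
  obtain ⟨f, hf, h0, h1⟩ := hx
  obtain ⟨g, hg⟩ := exists_map_eq_of_coeff_mem (residue v.valuationSubring)
    (E := residueSubfield v E) (f := f) fun n => ⟨f.coeff n, hf n, rfl⟩
  refine isSeparable_of_simple_root (g := g) ?_ ?_
  · rw [← eval_map_algebraMap, hg, eval_map_residue, h0, map_zero]
  · rw [← eval_map_algebraMap, ← derivative_map, hg, derivative_map, eval_map_residue]
    exact h1

/-- Uniqueness in Hensel's lemma. -/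
theorem eq_of_residue_eq_of_simple_root {A : Type*} [CommRing A] [IsLocalRing A] {f : A[X]}
    {x y : A} (hx : f.eval x = 0) (hy : f.eval y = 0) (hd : residue A (f.derivative.eval x) ≠ 0)
    (hxy : residue A x = residue A y) : y = x := by
  obtain ⟨z, hz⟩ := f.binomExpansion x (y - x)
  rw [add_sub_cancel, hx, hy, zero_add] at hz
  have hu : IsUnit (f.derivative.eval x + z * (y - x)) := by
    rw [← residue_ne_zero_iff_isUnit, map_add, map_mul, map_sub, hxy, sub_self, mul_zero, add_zero]
    exact hd
  have h0 : (f.derivative.eval x + z * (y - x)) * (y - x) = 0 := by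
    rw [hz]; ring
  exact sub_eq_zero.1 ((hu.mul_right_eq_zero).1 h0)

/-- A Hensel root lies in every field whose residue field contains its residue: automorphisms over
such a field preserve the residue, as they preserve the valuation, so they fix the root. -/
theorem IsHenselRoot.mem_of_residue_mem [IsAlgClosed Ω] {k E F : Subfield Ω}
    (hk : IsCompleteDiscrete v k) (hkF : k ≤ F) (hEF : E ≤ F) {x : v.valuationSubring}
    (hx : IsHenselRoot v E x) (hres : residue v.valuationSubring x ∈ residueSubfield v F) :
    (x : Ω) ∈ F := by
  refine mem_of_forall_fixed (fun z => isAlgebraic_of_le hkF (hk.isAlgebraic z))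
    (hx.mono hEF).isSeparable fun σ hσ => ?_
  obtain ⟨f, hf, h0, h1⟩ := hx
  obtain ⟨b, hb, hbx⟩ := mem_residueSubfield.1 hres
  have hinv := hk.map_eq σ fun z hz => hσ z (hkF hz)
  have hσx : v (σ x) ≤ 1 := by rw [hinv]; exact x.2
  have hy0 : f.eval (⟨σ x, hσx⟩ : v.valuationSubring) = 0 := by
    apply Subtype.ext
    rw [← eval_map_subtype]
    have h2 : (σ : Ω →+* Ω) ((f.map v.valuationSubring.subtype).eval (x : Ω)) = 0 := by
      rw [eval_map_subtype, h0]; simp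
    refine Eq.trans ?_ h2
    rw [eval_map, eval_map, hom_eval₂, eval₂_eq_sum, eval₂_eq_sum]
    refine Finset.sum_congr rfl fun n _ => ?_
    refine congrArg (· * σ x ^ n) ?_
    exact (hσ _ (hEF (hf n))).symm
  have hres' : residue v.valuationSubring x =
      residue v.valuationSubring (⟨σ x, hσx⟩ : v.valuationSubring) := by
    rw [← hbx, residue_eq_iff, ← Valuation.map_neg, neg_sub]
    rw [eq_comm, residue_eq_iff] at hbx
    have h3 : σ x - b = σ (x - b) := by rw [map_sub, hσ b hb]
    change v (σ x - b) < 1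
    rwa [h3, hinv]
  exact congrArg Subtype.val (eq_of_residue_eq_of_simple_root h0 hy0 h1 hres')

/-- Every algebraic residue is the residue of a root of a monic lift of its minimal polynomial. -/
theorem exists_lift_root [IsAlgClosed Ω] {E : Subfield Ω} {a : ResidueField v.valuationSubring}
    (ha : IsAlgebraic (residueSubfield v E) a) :
    ∃ (f : v.valuationSubring[X]) (x : v.valuationSubring), f.Monic ∧
      (∀ n, (f.coeff n : Ω) ∈ E) ∧
      f.map (residue v.valuationSubring) = (minpoly (residueSubfield v E) a).map
        (algebraMap (residueSubfield v E) (ResidueField v.valuationSubring)) ∧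
      f.eval x = 0 ∧ residue v.valuationSubring x = a := by
  set R : Subring v.valuationSubring := E.toSubring.comap v.valuationSubring.subtype with hR
  set g := (minpoly (residueSubfield v E) a).map
        (algebraMap (residueSubfield v E) (ResidueField v.valuationSubring)) with hg
  have hgm : g.Monic := (minpoly.monic ha.isIntegral).map _
  have hlift : g ∈ lifts ((residue v.valuationSubring).comp R.subtype) := by
    rw [lifts_iff_coeff_lifts]
    intro n
    rw [hg, coeff_map]
    obtain ⟨y, hy, h⟩ := ((minpoly (residueSubfield v E) a).coeff n).2
    exact ⟨⟨y, hy⟩, h⟩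
  obtain ⟨q, hq, -, hqm⟩ := lifts_and_degree_eq_and_monic hlift hgm
  have hfm : (q.map R.subtype).Monic := hqm.map _
  have hfg : (q.map R.subtype).map (residue v.valuationSubring) = g := by
    rw [Polynomial.map_map, hq]
  obtain ⟨a₀, ha₀⟩ := residue_surjective (R := v.valuationSubring) a
  -- as `f(a₀)` has residue `0`, some root of `f` is congruent to `a₀`
  have h0 : v (((q.map R.subtype).map v.valuationSubring.subtype).eval (a₀ : Ω)) < 1 := by
    rw [eval_map_subtype, ← residue_eq_zero_iff_lt, ← eval_map_residue, hfg, ha₀, hg,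
      eval_map_algebraMap, minpoly.aeval]
  have hsp : ((q.map R.subtype).map v.valuationSubring.subtype).Splits := IsAlgClosed.splits _
  have hm2 := hfm.map v.valuationSubring.subtype
  obtain ⟨r, hr, hra⟩ : ∃ r ∈ ((q.map R.subtype).map v.valuationSubring.subtype).roots,
      v ((a₀ : Ω) - r) < 1 := by
    by_contra! hcon
    rw [hsp.eq_prod_roots_of_monic hm2, eval_multiset_prod, Multiset.map_map,
      map_multiset_prod, Multiset.map_map] at h0
    refine absurd h0 (not_lt.2 ?_)
    refine Multiset.one_le_prod ?_
    intro y hy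
    obtain ⟨r, hr, rfl⟩ := Multiset.mem_map.1 hy
    simpa using hcon r hr
  have hr1 : v r ≤ 1 := by
    have h1 : r = a₀ - (a₀ - r) := by ring
    rw [h1]
    exact (Valuation.map_sub v _ _).trans (max_le a₀.2 hra.le)
  refine ⟨q.map R.subtype, ⟨r, hr1⟩, hfm, fun n => ?_, hfg, ?_, ?_⟩
  · rw [coeff_map]
    exact (q.coeff n).2
  · apply Subtype.ext
    rw [← eval_map_subtype]
    exact (mem_roots hm2.ne_zero).1 hr
  · rw [← ha₀, residue_eq_iff, ← Valuation.map_neg, neg_sub]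
    exact hra

theorem exists_eq_sum_of_mem_sup_closure {E : Subfield Ω} {x : Ω} {f : E[X]} (hf : f.Monic)
    (hx : aeval x f = 0) {z : Ω} (hz : z ∈ E ⊔ Subfield.closure {x}) :
    ∃ c : Fin f.natDegree → Ω, (∀ i, c i ∈ E) ∧ z = ∑ i, c i * x ^ (i : ℕ) := by
  rw [← adjoin_toSubfield_eq] at hz
  have hint : IsIntegral E x := ⟨f, hf, hx⟩
  have hz' : z ∈ (IntermediateField.adjoin E {x}).toSubalgebra := hz
  rw [IntermediateField.adjoin_simple_toSubalgebra_of_isAlgebraic hint.isAlgebraic,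
    Algebra.adjoin_singleton_eq_range_aeval] at hz'
  obtain ⟨q, rfl⟩ := hz'
  refine ⟨fun i => ((q %ₘ f).coeff i : E), fun i => Subtype.property _, ?_⟩
  by_cases hf1 : f = 1
  · simp [hf1] at hx
  have h1 : aeval x q = aeval x (q %ₘ f) := by
    conv_lhs => rw [← modByMonic_add_div q f]
    simp [hx]
  have h2 : (q %ₘ f).natDegree < f.natDegree := natDegree_modByMonic_lt q hf hf1
  change aeval x q = _
  rw [h1, aeval_eq_sum_range' h2, Finset.sum_range]
  rfl

/-- The extension of `E` generated by a Hensel root `x` that lifts a primitive residue `a` is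
unramified with residue field generated by `a`: the powers of `x` are an orthogonal basis. -/
theorem valuation_and_residue_of_mem_sup_closure [IsAlgClosed Ω] {E : Subfield Ω}
    {a : ResidueField v.valuationSubring} (ha : IsSeparable (residueSubfield v E) a) :
    ∃ x : v.valuationSubring, IsHenselRoot v E x ∧ residue v.valuationSubring x = a ∧
      (∀ z ∈ E ⊔ Subfield.closure {(x : Ω)}, ∃ y ∈ E, v z = v y) ∧
      residueSubfield v (E ⊔ Subfield.closure {(x : Ω)}) =
        residueSubfield v E ⊔ Subfield.closure {a} := by
  obtain ⟨f, x, hfm, hf, hfg, h0, hx⟩ := exists_lift_root ha.isIntegral.isAlgebraic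
  have hH : IsHenselRoot v E x := by
    refine ⟨f, hf, h0, ?_⟩
    rw [← eval_map_residue, ← derivative_map, hfg, derivative_map, hx, eval_map_algebraMap]
    exact ha.aeval_derivative_ne_zero (minpoly.aeval _ _)
  obtain ⟨g, hg⟩ := exists_map_eq_of_coeff_mem v.valuationSubring.subtype hf
  have hgm : g.Monic := by
    rw [← monic_map_iff (f := algebraMap E Ω), hg]
    exact hfm.map _
  have hgd : g.natDegree = (minpoly (residueSubfield v E) a).natDegree := by
    rw [← natDegree_map (algebraMap E Ω), hg, hfm.natDegree_map,
      ← hfm.natDegree_map (residue v.valuationSubring), hfg, natDegree_map]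
  have hg0 : aeval (x : Ω) g = 0 := by
    rw [← eval_map_algebraMap, hg, eval_map_subtype, h0]; rfl
  have hrep : ∀ z ∈ E ⊔ Subfield.closure {(x : Ω)},
      ∃ c : Fin (minpoly (residueSubfield v E) a).natDegree → Ω, (∀ i, c i ∈ E) ∧
        z = ∑ i, c i * ((x ^ (i : ℕ) : v.valuationSubring) : Ω) := by
    intro z hz
    have := exists_eq_sum_of_mem_sup_closure hgm hg0 hz
    rw [hgd] at this
    exact this
  have hli : LinearIndependent (residueSubfield v E)
      fun i : Fin (minpoly (residueSubfield v E) a).natDegree =>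
        residue v.valuationSubring (x ^ (i : ℕ)) := by
    simp only [map_pow, hx]
    exact linearIndependent_pow a
  refine ⟨x, hH, hx, fun z hz => ?_, le_antisymm ?_ (sup_le (residueSubfield_mono le_sup_left) ?_)⟩
  · obtain ⟨c, hc, rfl⟩ := hrep z hz
    have hpos : 0 < (minpoly (residueSubfield v E) a).natDegree :=
      minpoly.natDegree_pos ha.isIntegral
    obtain ⟨m, -, hm⟩ := Finset.exists_max_image Finset.univ (fun j => v (c j))
      ⟨⟨0, hpos⟩, Finset.mem_univ _⟩
    refine ⟨c m, hc m, le_antisymm (Valuation.map_sum_le v fun j hj => ?_)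
      (le_valuation_sum_of_linearIndependent hli hc m)⟩
    rw [map_mul]
    exact (mul_le_of_le_one_right zero_le (x ^ (j : ℕ)).2).trans (hm j hj)
  · intro b hb
    obtain ⟨z, hz, rfl⟩ := mem_residueSubfield.1 hb
    obtain ⟨c, hc, hzc⟩ := hrep z hz
    have hc1 : ∀ i, v (c i) ≤ 1 := fun i =>
      (le_valuation_sum_of_linearIndependent hli hc i).trans (hzc ▸ z.2)
    have h1 : z = ∑ i, (⟨c i, hc1 i⟩ : v.valuationSubring) * x ^ (i : ℕ) := by
      apply Subtype.ext
      rw [hzc]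
      push_cast
      rfl
    rw [h1, map_sum]
    refine sum_mem fun i _ => ?_
    rw [map_mul, map_pow, hx]
    have h2 : residue v.valuationSubring ⟨c i, hc1 i⟩ ∈ residueSubfield v E :=
      mem_residueSubfield.2 ⟨⟨c i, hc1 i⟩, hc i, rfl⟩
    have hle : residueSubfield v E ≤ residueSubfield v E ⊔ Subfield.closure {a} := le_sup_left
    have h3 : a ∈ residueSubfield v E ⊔ Subfield.closure {a} :=
      mem_sup_closure (Set.mem_singleton a)
    exact mul_mem (hle h2) (pow_mem h3 _)
  · rw [Subfield.closure_le, Set.singleton_subset_iff]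
    exact mem_residueSubfield.2 ⟨x, mem_sup_closure rfl, hx⟩

theorem exists_isHenselRoot [IsAlgClosed Ω] {E : Subfield Ω}
    {a : ResidueField v.valuationSubring} (ha : IsSeparable (residueSubfield v E) a) :
    ∃ x : v.valuationSubring, IsHenselRoot v E x ∧ residue v.valuationSubring x = a := by
  obtain ⟨x, hx, hxa, -⟩ := valuation_and_residue_of_mem_sup_closure ha
  exact ⟨x, hx, hxa⟩

end Unramified

/-! ### Unramified extensions -/

section Unramified

variable {Ω : Type*} [Field Ω] {v : Valuation Ω ℝ≥0}

open IsLocalRing Polynomial Filter Topology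

theorem IsUnramifiedExt.of_le {E T U : Subfield Ω} (h : IsUnramifiedExt v E U) (h1 : E ≤ T)
    (h2 : T ≤ U) : IsUnramifiedExt v E T :=
  ⟨⟨h1, fun x hx => h.1.2 x (h2 hx)⟩, fun a ha => h.2 a (residueSubfield_mono h2 ha)⟩

variable [IsAlgClosed Ω]

theorem isUnramifiedExt_unramifiedClosure {k E : Subfield Ω} (hk : IsCompleteDiscrete v k)
    (hkE : k ≤ E) : IsUnramifiedExt v E (unramifiedClosure v E) := by
  -- every element of the compositum lies in an extension generated by one Hensel root
  have key : ∀ z ∈ unramifiedClosure v E, ∃ a, IsSeparable (residueSubfield v E) a ∧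
      ∃ x : v.valuationSubring, z ∈ E ⊔ Subfield.closure {(x : Ω)} ∧
      (∀ z ∈ E ⊔ Subfield.closure {(x : Ω)}, ∃ y ∈ E, v z = v y) ∧
      residueSubfield v (E ⊔ Subfield.closure {(x : Ω)}) =
        residueSubfield v E ⊔ Subfield.closure {a} := by
    classical
    intro z hz
    obtain ⟨T, hT, hzT⟩ := exists_finset_of_mem_sup_closure hz
    obtain ⟨T, hT', rfl⟩ := Finset.subset_set_image_iff.1 hT
    obtain ⟨a, ha, haT⟩ := exists_primitive_element_of_separable
      (T := T.image (residue v.valuationSubring)) (k := residueSubfield v E) (by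
        intro b hb
        obtain ⟨y, hy, rfl⟩ := Finset.mem_image.1 hb
        exact IsHenselRoot.isSeparable_residue (hT' hy))
    obtain ⟨x, -, hxa, hv, hres⟩ := valuation_and_residue_of_mem_sup_closure ha
    refine ⟨a, ha, x, ?_, hv, hres⟩
    refine (sup_le le_sup_left (Subfield.closure_le.2 ?_) :
      E ⊔ Subfield.closure ((T.image Subtype.val : Finset Ω) : Set Ω) ≤ _) hzT
    intro w hw
    obtain ⟨y, hy, rfl⟩ := Finset.mem_image.1 (Finset.mem_coe.1 hw)
    refine IsHenselRoot.mem_of_residue_mem hk (hkE.trans le_sup_left) le_sup_left (hT' hy) ?_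
    rw [hres, haT]
    exact mem_sup_closure (by simpa using ⟨y, y.2, hy, rfl⟩)
  refine ⟨⟨le_sup_left, fun z hz => ?_⟩, fun b hb => ?_⟩
  · obtain ⟨a, -, x, hzx, hv, -⟩ := key z hz
    exact hv z hzx
  · obtain ⟨z, hz, rfl⟩ := mem_residueSubfield.1 hb
    obtain ⟨a, ha, x, hzx, -, hres⟩ := key z hz
    have h1 : residue v.valuationSubring z ∈ residueSubfield v (E ⊔ Subfield.closure {(x : Ω)}) :=
      mem_residueSubfield.2 ⟨z, hzx, rfl⟩
    rw [hres] at h1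
    exact isSeparable_of_mem_closure (by rintro _ rfl; exact ha) h1

/-- An unramified extension has no defect: by discreteness and completeness, elements can be
approximated by Hensel roots up to an arbitrarily small error, hence exactly. -/
theorem IsUnramifiedExt.le_unramifiedClosure {k E U : Subfield Ω} (hk : IsCompleteDiscrete v k)
    (hkE : IsFiniteExt k E) (hU : IsUnramifiedExt v E U) : U ≤ unramifiedClosure v E := by
  intro u hu
  set R := E ⊔ Subfield.closure {u} with hR
  have hRU : R ≤ U := sup_le hU.1.1 (Subfield.closure_le.2 (Set.singleton_subset_iff.2 hu))
  have hER : IsFiniteExt E R := isFiniteExt_sup_closure (Set.finite_singleton u) fun x _ =>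
    isAlgebraic_of_le hkE.1 (hk.isAlgebraic x)
  have hkR := hkE.trans hER
  obtain ⟨c, hc1, hc⟩ := hk.discrete_of_isFiniteExt hkR
  have hS : IsSeqComplete v ((R ⊓ unramifiedClosure v E : Subfield Ω) : Set Ω) :=
    hk.complete.of_isFiniteExt
      (hkR.left (le_inf hkR.1 (hkE.1.trans le_sup_left)) inf_le_left)
  have step : ∀ z ∈ R, ∃ y ∈ R ⊓ unramifiedClosure v E, v (z - y) ≤ c * v z := by
    intro z hz
    by_cases hz0 : z = 0
    · exact ⟨0, zero_mem _, by simp [hz0]⟩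
    obtain ⟨e, he, hve⟩ := hU.1.2 z (hRU hz)
    have he0 : e ≠ 0 := by
      rintro rfl
      rw [map_zero, map_eq_zero] at hve
      exact hz0 hve
    have hw1 : v (z / e) ≤ 1 := by
      rw [map_div₀, hve, div_self]
      exact (map_ne_zero v).2 he0
    have hwR : z / e ∈ R := div_mem hz (hER.1 he)
    obtain ⟨x, hx, hxw⟩ := exists_isHenselRoot (v := v) (E := E)
      (hU.2 (residue v.valuationSubring ⟨z / e, hw1⟩) (mem_residueSubfield.2 ⟨_, hRU hwR, rfl⟩))
    have hxR : (x : Ω) ∈ R := hx.mem_of_residue_mem hk hkR.1 hER.1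
      (mem_residueSubfield.2 ⟨⟨z / e, hw1⟩, hwR, hxw.symm⟩)
    refine ⟨e * x, mul_mem ⟨hER.1 he, (le_sup_left : E ≤ unramifiedClosure v E) he⟩
      ⟨hxR, hx.mem_unramifiedClosure⟩, ?_⟩
    have h1 : z - e * x = (z / e - x) * e := by field_simp
    rw [h1, map_mul, hve]
    gcongr
    exact hc _ (sub_mem hwR hxR) (residue_eq_iff.1 hxw.symm)
  have approx : ∀ n : ℕ, ∃ y ∈ R ⊓ unramifiedClosure v E, v (u - y) ≤ c ^ n * v u := by
    intro n
    induction n with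
    | zero => exact ⟨0, zero_mem _, by simp⟩
    | succ n ih =>
      obtain ⟨y, hy, hyn⟩ := ih
      obtain ⟨y', hy', hyn'⟩ := step (u - y) (sub_mem (mem_sup_closure rfl) hy.1)
      refine ⟨y + y', add_mem hy hy', ?_⟩
      rw [← sub_sub, pow_succ', mul_assoc]
      exact hyn'.trans (by gcongr)
  refine (hS.mem_of_isLimitOf fun ε hε => ?_).2
  have h0 : Tendsto (fun n : ℕ => c ^ n * v u) atTop (𝓝 0) := by
    simpa using (NNReal.tendsto_pow_atTop_nhds_zero_of_lt_one hc1).mul_const (v u)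
  obtain ⟨n, hn⟩ := (h0.eventually_lt_const hε).exists
  obtain ⟨y, hy, hyn⟩ := approx n
  exact ⟨y, hy, hyn.trans_lt hn⟩

theorem isUnramifiedExt_iff {k E T : Subfield Ω} (hk : IsCompleteDiscrete v k)
    (hkE : IsFiniteExt k E) :
    IsUnramifiedExt v E T ↔ E ≤ T ∧ T ≤ unramifiedClosure v E :=
  ⟨fun h => ⟨h.1.1, h.le_unramifiedClosure hk hkE⟩,
    fun h => (isUnramifiedExt_unramifiedClosure hk hkE.1).of_le h.1 h.2⟩

/-- Some power of a residue that is separable over the residue field of `F` is separable over that of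
`E`, so the compositum on the right has the residues of all Hensel roots over `F`. -/
theorem unramifiedClosure_eq_sup {k E F : Subfield Ω} (hk : IsCompleteDiscrete v k)
    (hkE : k ≤ E) (hEF : IsFiniteExt E F) :
    unramifiedClosure v F = F ⊔ unramifiedClosure v E := by
  refine le_antisymm (sup_le le_sup_left (Subfield.closure_le.2 ?_))
    (sup_le le_sup_left (unramifiedClosure_mono hEF.1))
  rintro _ ⟨x, hx, rfl⟩
  refine IsHenselRoot.mem_of_residue_mem hk (hkE.trans (hEF.1.trans le_sup_left)) le_sup_left hx ?_
  have hs := IsHenselRoot.isSeparable_residue hx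
  set a := residue v.valuationSubring x
  have hle : residueSubfield v F ≤ residueSubfield v (F ⊔ unramifiedClosure v E) :=
    residueSubfield_mono le_sup_left
  have halg : IsAlgebraic (residueSubfield v E) a :=
    isAlgebraic_trans (fun y hy => hEF.residueSubfield.isAlgebraic hy) hs.isIntegral.isAlgebraic
  -- a power of `a` is separable over the residue field of `E`, hence the residue of a Hensel root
  obtain ⟨q, hq⟩ := ExpChar.exists (residueSubfield v E)
  obtain ⟨n, hn⟩ := exists_isSeparable_pow q halg
  obtain ⟨y, hy, hya⟩ := exists_isHenselRoot hn
  have : ExpChar (ResidueField v.valuationSubring) q := expChar_of_injective_algebraMap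
    (algebraMap (residueSubfield v E) (ResidueField v.valuationSubring)).injective q
  have : ExpChar (residueSubfield v (F ⊔ unramifiedClosure v E)) q :=
    (algebraMap (residueSubfield v (F ⊔ unramifiedClosure v E))
      (ResidueField v.valuationSubring)).expChar (RingHom.injective _) q
  refine mem_of_isSeparable_of_pow_mem q (isSeparable_of_le hle hs) (n := n) ?_
  exact mem_residueSubfield.2
    ⟨y, (le_sup_right : unramifiedClosure v E ≤ _) hy.mem_unramifiedClosure, hya⟩

end Unramified

/-! ### The maximal perfect subfield -/

section PerfectCore

variable {κ : Type*} [Field κ]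

theorem linearIndependent_of_subfield_le {ι : Type*} {E F : Subfield κ} (h : E ≤ F) {e : ι → κ}
    (he : LinearIndependent F e) : LinearIndependent E e := by
  let _ := (Subfield.inclusion h).toAlgebra
  have : IsScalarTower E F κ := IsScalarTower.of_algebraMap_eq fun _ => rfl
  refine he.restrict_scalars ?_
  intro a b hab
  simp only [Algebra.smul_def, mul_one] at hab
  exact (algebraMap E F).injective hab

/-- Vectors that are linearly independent over the intersection of a decreasing sequence of fields
are linearly independent over one of them. -/
theorem exists_linearIndependent_of_iInf {k : ℕ → Subfield κ} (hk : Antitone k) :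
    ∀ {m : ℕ} {e : Fin m → κ}, LinearIndependent (⨅ n, k n : Subfield κ) e →
      ∃ n, LinearIndependent (k n) e := by
  intro m
  induction m with
  | zero => exact fun _ => ⟨0, linearIndependent_empty_type⟩
  | succ m ih =>
    intro e he
    obtain ⟨e, x, rfl⟩ : ∃ (e' : Fin m → κ) (x : κ), e = Fin.snoc e' x :=
      ⟨Fin.init e, e (Fin.last m), (Fin.snoc_init_self e).symm⟩
    rw [linearIndependent_finSnoc] at he
    obtain ⟨n₀, hn₀⟩ := ih he.1
    by_contra! hcon
    -- otherwise `x` has coordinates in every `k n`, and these do not depend on `n`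
    have hspan : ∀ n, n₀ ≤ n → ∃ c : Fin m → κ, (∀ i, c i ∈ k n) ∧ ∑ i, c i * e i = x := by
      intro n hn
      have h1 := hcon n
      rw [linearIndependent_finSnoc, not_and, not_not] at h1
      obtain ⟨c, hc⟩ := (Submodule.mem_span_range_iff_exists_fun _).1
        (h1 (linearIndependent_of_subfield_le (hk hn) hn₀))
      exact ⟨fun i => c i, fun i => (c i).2, hc⟩
    obtain ⟨c, hc, hcx⟩ := hspan n₀ le_rfl
    refine he.2 ((Submodule.mem_span_range_iff_exists_fun _).2
      ⟨fun i => ⟨c i, Subfield.mem_iInf.2 fun n => ?_⟩, hcx⟩)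
    obtain ⟨d, hd, hdx⟩ := hspan (max n n₀) (le_max_right _ _)
    have h2 : c i - d i = 0 := by
      have h3 := Fintype.linearIndependent_iff.1 hn₀
        (fun i => ⟨c i - d i, sub_mem (hc i) (hk (le_max_right _ _) (hd i))⟩) (by
          change ∑ i, (c i - d i) * e i = 0
          simp only [sub_mul, Finset.sum_sub_distrib, hcx, hdx, sub_self]) i
      exact congrArg Subtype.val h3
    rw [sub_eq_zero.1 h2]
    exact hk (le_max_left _ _) (hd i)

variable (p : ℕ) [ExpChar κ p]

/-- The maximal perfect subfield `⋂ k ^ (p ^ n)` of a field `k` of characteristic `p`. -/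
def perfectCore (k : Subfield κ) : Subfield κ := ⨅ n, k.map (iterateFrobenius κ p n)

variable {p}

theorem mem_perfectCore {k : Subfield κ} {a : κ} :
    a ∈ perfectCore p k ↔ ∀ n : ℕ, ∃ b ∈ k, b ^ p ^ n = a := by
  simp [perfectCore, Subfield.mem_iInf, Subfield.mem_map, iterateFrobenius_def]

theorem perfectCore_mono {k k' : Subfield κ} (h : k ≤ k') : perfectCore p k ≤ perfectCore p k' :=
  fun a ha => mem_perfectCore.2 fun n => by
    obtain ⟨b, hb, hba⟩ := mem_perfectCore.1 ha n
    exact ⟨b, h hb, hba⟩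

/-- The maximal perfect subfield is perfect. -/
theorem exists_pow_eq_of_mem_perfectCore {k : Subfield κ} {a : κ} (ha : a ∈ perfectCore p k)
    (n : ℕ) : ∃ b ∈ perfectCore p k, b ^ p ^ n = a := by
  obtain ⟨b, hb, hba⟩ := mem_perfectCore.1 ha n
  refine ⟨b, mem_perfectCore.2 fun m => ?_, hba⟩
  obtain ⟨c, hc, hca⟩ := mem_perfectCore.1 ha (m + n)
  refine ⟨c, hc, iterateFrobenius_inj κ p n ?_⟩
  rw [iterateFrobenius_def, iterateFrobenius_def, hba, ← hca, ← pow_mul, ← pow_add]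

/-- The maximal perfect subfield of a finite extension `k'/k` is finite over that of `k`: by
injectivity of Frobenius, elements of it that are linearly independent over some `k ^ (p ^ n)` have
`p ^ n`-th roots linearly independent over `k`. -/
theorem IsFiniteExt.perfectCore {k k' : Subfield κ} (h : IsFiniteExt k k') :
    IsFiniteExt (perfectCore p k) (perfectCore p k') := by
  obtain ⟨N, hN, rfl⟩ := isFiniteExt_iff.1 h
  have hle := perfectCore_mono (p := p) h.1
  refine isFiniteExt_iff.2 ⟨Subfield.extendScalars hle, ?_, rfl⟩
  have hr : Module.rank (LowerRamification.perfectCore p k) (Subfield.extendScalars hle) ≤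
      Module.finrank k N := by
    refine rank_le fun s hs => ?_
    have h1 : LinearIndependent (LowerRamification.perfectCore p k)
        fun a : s => ((a : Subfield.extendScalars hle) : κ) :=
      hs.map' (Subfield.extendScalars hle).val.toLinearMap (LinearMap.ker_eq_bot.2
        (Subfield.extendScalars hle).val.injective)
    have h2 := h1.comp _ s.equivFin.symm.injective
    obtain ⟨n, hn⟩ := exists_linearIndependent_of_iInf (k := fun n =>
      k.map (iterateFrobenius κ p n)) (antitone_nat_of_succ_le fun n => by
        rintro _ ⟨b, hb, rfl⟩
        exact ⟨b ^ p, k.pow_mem hb p, by simp [iterateFrobenius_def, ← pow_mul, pow_succ']⟩) h2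
    have hroot : ∀ i : Fin s.card, ∃ b ∈ N, b ^ p ^ n =
        (((s.equivFin.symm i : s) : Subfield.extendScalars hle) : κ) := fun i =>
      mem_perfectCore.1 (s.equivFin.symm i).1.2 n
    choose b hbN hb using hroot
    have h3 : LinearIndependent k fun i => (⟨b i, hbN i⟩ : N) := by
      refine LinearIndependent.of_comp N.val.toLinearMap ?_
      rw [Fintype.linearIndependent_iff] at hn ⊢
      intro g hg i
      have h4 := hn (fun i => ⟨(g i : κ) ^ p ^ n, g i, (g i).2, rfl⟩) (by
        have h5 : iterateFrobenius κ p n (∑ i, (g i : κ) * b i) = 0 := by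
          have h6 : ∑ i, (g i : κ) * b i = 0 := hg
          rw [h6, map_zero]
        rw [map_sum] at h5
        simp only [map_mul, iterateFrobenius_def, hb] at h5
        exact h5) i
      have h5 : (g i : κ) ^ p ^ n = 0 := congrArg Subtype.val h4
      exact Subtype.ext ((pow_eq_zero_iff (expChar_pow_pos κ p n).ne').1 h5)
    simpa using h3.fintype_card_le_finrank
  exact Module.rank_lt_aleph0_iff.1 (hr.trans_lt Cardinal.natCast_lt_aleph0)

end PerfectCore

/-! ### Teichmüller representatives -/

section Constant

variable {Ω : Type*} [Field Ω] {v : Valuation Ω ℝ≥0} {p : ℕ}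

open IsLocalRing Filter Topology

theorem teichmullerSet_mono {E F : Subfield Ω} (h : E ≤ F) :
    teichmullerSet v p E ⊆ teichmullerSet v p F := fun x hx =>
  ⟨h hx.1, hx.2.1, fun n => by
    obtain ⟨y, hy, hyx⟩ := hx.2.2 n
    exact ⟨y, h hy, hyx⟩⟩

/-- A common bound for the values less than `1` in `E` and the value of `p`. -/
theorem IsDiscreteSubfield.exists_bound {E : Subfield Ω} (hE : IsDiscreteSubfield v E)
    (hvp : v (p : Ω) < 1) :
    ∃ c : ℝ≥0, 0 < c ∧ c < 1 ∧ v (p : Ω) ≤ c ∧ ∀ x ∈ E, v x < 1 → v x ≤ c := by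
  obtain ⟨c, hc1, hc⟩ := hE
  exact ⟨max (max c (v p)) (1 / 2), lt_max_of_lt_right (by norm_num),
    max_lt (max_lt hc1 hvp) (by rw [div_lt_one] <;> norm_num),
    (le_max_right _ _).trans (le_max_left _ _), fun x hx hx1 =>
      (hc x hx hx1).trans ((le_max_left _ _).trans (le_max_left _ _))⟩

variable [hp : Fact p.Prime]

theorem charP_residueField (hvp : v (p : Ω) < 1) : CharP (ResidueField v.valuationSubring) p := by
  rw [CharP.charP_iff_prime_eq_zero hp.out]
  have h := residue_eq_zero_iff_lt (x := (p : v.valuationSubring)).2 (by exact_mod_cast hvp)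
  rwa [map_natCast] at h

theorem valuation_pow_sub_pow_le {c r : ℝ≥0} (hvp : v (p : Ω) ≤ c) (hrc : r ≤ c)
    {a b : v.valuationSubring} (hab : v ((a : Ω) - b) ≤ r) :
    v ((a : Ω) ^ p - (b : Ω) ^ p) ≤ c * r := by
  obtain ⟨s, hs⟩ := exists_add_pow_prime_eq hp.out b (a - b)
  rw [add_sub_cancel] at hs
  obtain ⟨q, hq⟩ : ∃ q, p = q + 1 + 1 := ⟨p - 2, by have := hp.out.two_le; omega⟩
  have h1 : (a : Ω) ^ p - (b : Ω) ^ p =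
      ((a : Ω) - b) ^ q * ((a : Ω) - b) * ((a : Ω) - b) + p * (b * s) * ((a : Ω) - b) := by
    have h2 := congrArg (Subtype.val : v.valuationSubring → Ω) hs
    push_cast at h2
    rw [h2, ← pow_succ, ← pow_succ, ← hq]
    ring
  have hr1 : v ((a : Ω) - b) ≤ 1 := (a - b).2
  rw [h1]
  refine (Valuation.map_add v _ _).trans (max_le ?_ ?_)
  · rw [map_mul, map_mul, map_pow]
    gcongr
    exact (mul_le_of_le_one_left zero_le (pow_le_one₀ zero_le hr1)).trans (hab.trans hrc)
  · rw [map_mul, map_mul]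
    gcongr
    exact (mul_le_of_le_one_right zero_le (b * s).2).trans hvp

theorem valuation_pow_pow_sub_le {c : ℝ≥0} (hc : c ≤ 1) (hvp : v (p : Ω) ≤ c)
    {a b : v.valuationSubring} (hab : v ((a : Ω) - b) ≤ c) (n : ℕ) :
    v ((a : Ω) ^ p ^ n - (b : Ω) ^ p ^ n) ≤ c ^ (n + 1) := by
  induction n with
  | zero => simpa using hab
  | succ n ih =>
    have h := valuation_pow_sub_pow_le (a := a ^ p ^ n) (b := b ^ p ^ n) hvp
      (pow_le_of_le_one zero_le hc n.succ_ne_zero) (by simpa using ih)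
    rw [pow_succ p, pow_mul, pow_mul, pow_succ' c]
    simpa using h

theorem valuation_le_one_of_pow {y : Ω} {n : ℕ} (h : v (y ^ p ^ n) ≤ 1) : v y ≤ 1 := by
  rw [map_pow] at h
  exact (pow_le_one_iff_of_nonneg zero_le (pow_pos hp.out.pos n).ne').1 h

theorem tendsto_pow_succ_zero {c : ℝ≥0} (hc : c < 1) :
    Tendsto (fun n : ℕ => c ^ (n + 1)) atTop (𝓝 0) :=
  (tendsto_add_atTop_iff_nat 1).2 (NNReal.tendsto_pow_atTop_nhds_zero_of_lt_one hc)

/-- A Teichmüller representative is determined by its residue. -/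
theorem eq_of_mem_teichmullerSet {E : Subfield Ω} (hE : IsDiscreteSubfield v E)
    (hvp : v (p : Ω) < 1) {x y : v.valuationSubring} (hx : (x : Ω) ∈ teichmullerSet v p E)
    (hy : (y : Ω) ∈ teichmullerSet v p E)
    (hxy : residue v.valuationSubring x = residue v.valuationSubring y) : (x : Ω) = y := by
  obtain ⟨c, -, hc1, hpc, hc⟩ := hE.exists_bound hvp
  have := charP_residueField hvp
  have hle : ∀ n : ℕ, v ((x : Ω) - y) ≤ c ^ (n + 1) := by
    intro n
    obtain ⟨a, ha, hax⟩ := hx.2.2 n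
    obtain ⟨b, hb, hby⟩ := hy.2.2 n
    have ha1 : v a ≤ 1 := valuation_le_one_of_pow (p := p) (n := n) (hax ▸ x.2)
    have hb1 : v b ≤ 1 := valuation_le_one_of_pow (p := p) (n := n) (hby ▸ y.2)
    have hab : residue v.valuationSubring ⟨a, ha1⟩ = residue v.valuationSubring ⟨b, hb1⟩ := by
      refine iterateFrobenius_inj _ p n ?_
      rw [iterateFrobenius_def, iterateFrobenius_def, ← map_pow, ← map_pow]
      convert hxy
      · exact Subtype.ext hax
      · exact Subtype.ext hby
    rw [← hax, ← hby]
    exact valuation_pow_pow_sub_le (a := ⟨a, ha1⟩) (b := ⟨b, hb1⟩) hc1.le hpc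
      (hc _ (sub_mem ha hb) (residue_eq_iff.1 hab)) n
  have h0 : v ((x : Ω) - y) ≤ 0 := ge_of_tendsto' (tendsto_pow_succ_zero hc1) hle
  exact sub_eq_zero.1 ((map_eq_zero v).1 (le_antisymm h0 zero_le))

theorem tendsto_pow_sub {x : Ω} {s : ℕ → Ω} (hs : ∀ n, v (s n) ≤ 1) (hx : v x ≤ 1)
    (h : Tendsto (fun n => v (x - s n)) atTop (𝓝 0)) (m : ℕ) :
    Tendsto (fun n => v (x ^ m - s n ^ m)) atTop (𝓝 0) := by
  refine tendsto_of_tendsto_of_tendsto_of_le_of_le tendsto_const_nhds h (fun _ => zero_le)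
    fun n => ?_
  obtain ⟨d, hd⟩ := sub_dvd_pow_sub_pow (⟨x, hx⟩ : v.valuationSubring) ⟨s n, hs n⟩ m
  have h2 : x ^ m - s n ^ m = (x - s n) * d := by
    simpa using congrArg (Subtype.val : v.valuationSubring → Ω) hd
  simp only
  rw [h2, map_mul]
  exact mul_le_of_le_one_right zero_le d.2

theorem valuation_le_of_tendsto {x y : Ω} {s : ℕ → Ω} {r : ℝ≥0}
    (h : Tendsto (fun n => v (x - s n)) atTop (𝓝 0)) (hr : 0 < r)
    (hs : ∀ n, v (s n - y) ≤ r) : v (x - y) ≤ r := by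
  obtain ⟨n, hn⟩ := (h.eventually_lt_const hr).exists
  have : x - y = (x - s n) + (s n - y) := by ring
  rw [this]
  exact (Valuation.map_add v _ _).trans (max_le hn.le (hs n))

/-- Existence of Teichmüller representatives: `lim b_n ^ (p ^ n)`, where `b_n` is a lift of the
`p ^ n`-th root of the residue. -/
theorem exists_mem_teichmullerSet {E : Subfield Ω} (hE : IsDiscreteSubfield v E)
    (hc : IsSeqComplete v (E : Set Ω)) (hvp : v (p : Ω) < 1)
    {a : ResidueField v.valuationSubring}
    (ha : ∀ n : ℕ, ∃ b ∈ residueSubfield v E, b ^ p ^ n = a) :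
    ∃ x : v.valuationSubring, (x : Ω) ∈ teichmullerSet v p E ∧
      residue v.valuationSubring x = a := by
  obtain ⟨c, hc0, hc1, hpc, hcE⟩ := hE.exists_bound hvp
  have := charP_residueField hvp
  have hex : ∀ n : ℕ, ∃ b : v.valuationSubring, (b : Ω) ∈ E ∧
      residue v.valuationSubring b ^ p ^ n = a := fun n => by
    obtain ⟨_, ⟨b, hb, rfl⟩, h⟩ := ha n
    exact ⟨b, hb, h⟩
  choose b hbE hb using hex
  -- the sequences `n ↦ b (n + m) ^ (p ^ n)`
  have hstep : ∀ m n, v ((b (n + 1 + m) : Ω) ^ p ^ (n + 1) - (b (n + m) : Ω) ^ p ^ n) ≤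
      c ^ (n + 1) := by
    intro m n
    have h1 : residue v.valuationSubring (b (n + 1 + m) ^ p) =
        residue v.valuationSubring (b (n + m)) := by
      refine iterateFrobenius_inj _ p (n + m) ?_
      rw [iterateFrobenius_def, iterateFrobenius_def, hb, map_pow, ← pow_mul, ← pow_succ',
        show n + m + 1 = n + 1 + m by ring, hb]
    have h2 := valuation_pow_pow_sub_le hc1.le hpc
      (hcE _ (sub_mem (pow_mem (hbE (n + 1 + m)) p) (hbE (n + m)))
        (by simpa using residue_eq_iff.1 h1)) n (a := b (n + 1 + m) ^ p) (b := b (n + m))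
    rw [pow_succ' p, pow_mul]
    simpa using h2
  have hlim : ∀ m, ∃ x ∈ E,
      Tendsto (fun n => v (x - (b (n + m) : Ω) ^ p ^ n)) atTop (𝓝 0) := fun m =>
    hc (fun n => (b (n + m) : Ω) ^ p ^ n) (fun n => pow_mem (hbE _) _)
      (tendsto_of_tendsto_of_tendsto_of_le_of_le tendsto_const_nhds (tendsto_pow_succ_zero hc1)
        (fun _ => zero_le) fun n => hstep m n)
  choose y hyE hy using hlim
  have hb1 : ∀ m n, v ((b (n + m) : Ω) ^ p ^ n) ≤ 1 := fun m n => (b (n + m) ^ p ^ n).2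
  have hy1 : ∀ m, v (y m) ≤ 1 := fun m => by
    simpa using valuation_le_of_tendsto (y := 0) (hy m) one_pos (by simpa using hb1 m)
  have hroot : ∀ m, y m ^ p ^ m = y 0 := fun m => by
    refine eq_zero_of_tendsto (v := v) (s := fun n => (b (n + m) : Ω) ^ p ^ (n + m)) ?_ ?_
    · have := tendsto_pow_sub (hb1 m) (hy1 m) (hy m) (p ^ m)
      simpa only [← pow_mul, ← pow_add] using this
    · exact (tendsto_add_atTop_iff_nat m).2 (hy 0)
  refine ⟨⟨y 0, hy1 0⟩, ⟨hyE 0, hy1 0, fun n => ⟨y n, hyE n, hroot n⟩⟩, ?_⟩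
  have h0 : residue v.valuationSubring (b 0) = a := by simpa using hb 0
  rw [← h0, residue_eq_iff]
  refine lt_of_le_of_lt (valuation_le_of_tendsto (hy 0) hc0 fun n => ?_) hc1
  induction n with
  | zero => simp
  | succ n ih =>
    have h3 : (b (n + 1 + 0) : Ω) ^ p ^ (n + 1) - b 0 =
        ((b (n + 1 + 0) : Ω) ^ p ^ (n + 1) - (b (n + 0) : Ω) ^ p ^ n) +
          ((b (n + 0) : Ω) ^ p ^ n - b 0) := by ring
    rw [h3]
    exact (Valuation.map_add v _ _).trans (max_le ((hstep 0 n).trans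
      (pow_le_of_le_one zero_le hc1.le n.succ_ne_zero)) ih)

theorem residue_mem_perfectCore [ExpChar (ResidueField v.valuationSubring) p] {E : Subfield Ω}
    {x : v.valuationSubring} (hx : (x : Ω) ∈ teichmullerSet v p E) :
    residue v.valuationSubring x ∈ perfectCore p (residueSubfield v E) :=
  mem_perfectCore.2 fun n => by
    obtain ⟨y, hy, hyx⟩ := hx.2.2 n
    refine ⟨residue v.valuationSubring
      ⟨y, valuation_le_one_of_pow (p := p) (n := n) (hyx ▸ x.2)⟩, ⟨_, hy, rfl⟩, ?_⟩
    rw [← map_pow]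
    congr 1
    exact Subtype.ext hyx

theorem mem_closureSubfield (hv : ∃ π : Ω, π ≠ 0 ∧ v π < 1) {E : Subfield Ω} {x : Ω} :
    x ∈ closureSubfield v E ↔ IsLimitOf v (E : Set Ω) x := by
  let _ := Valued.mk' v
  change x ∈ closure (E : Set Ω) ↔ _
  rw [mem_closure_iff_nhds]
  constructor
  · intro h ε hε
    obtain ⟨π, hπ0, hπ1⟩ := hv
    obtain ⟨n, hn⟩ := ((NNReal.tendsto_pow_atTop_nhds_zero_of_lt_one hπ1).eventually_lt_const
      hε).exists
    have h0 : Valued.v.restrict (π ^ n : Ω) ≠ 0 := by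
      simpa using fun h => (hπ0 h).elim
    obtain ⟨y, hy, hyE⟩ := h {y | Valued.v.restrict (y - x : Ω) < Valued.v.restrict (π ^ n : Ω)}
      (Valued.mem_nhds.2 ⟨Units.mk0 _ h0, subset_rfl⟩)
    refine ⟨y, hyE, ?_⟩
    have h1 : v (y - x) < v (π ^ n) := (Valuation.restrict_lt_iff _).1 hy
    rw [← Valuation.map_neg, neg_sub]
    rw [map_pow] at h1
    exact h1.trans hn
  · intro h t ht
    obtain ⟨γ, hγ⟩ := Valued.mem_nhds.1 ht
    obtain ⟨y, hy, hxy⟩ := h (MonoidWithZeroHom.ValueGroup₀.embedding γ.1)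
      (pos_iff_ne_zero.2 ((map_ne_zero _).2 γ.ne_zero))
    refine ⟨y, hγ ?_, hy⟩
    refine (Valuation.restrict_lt_iff_lt_embedding _).2 ?_
    rw [← Valuation.map_neg, neg_sub]
    exact hxy

/-- A description of `k₀` covering both characteristics. -/
theorem constantBase_eq (v : Valuation Ω ℝ≥0) (p : ℕ) (B : Subfield Ω) :
    ∃ D : Set Ω, D ⊆ B ∧ ∀ E : Subfield Ω, constantBase v p B E =
      closureSubfield v (Subfield.closure (D ∪ teichmullerSet v p E)) := by
  by_cases h : (p : Ω) = 0
  · exact ⟨B, subset_rfl, fun E => by rw [constantBase, if_pos h]⟩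
  · exact ⟨∅, Set.empty_subset _, fun E => by rw [constantBase, if_neg h, Set.empty_union]⟩

end Constant

/-! ### Constant subfields of finite extensions -/

section ConstantField

variable {Ω : Type*} [Field Ω] {v : Valuation Ω ℝ≥0} {p : ℕ}

open IsLocalRing Filter Topology

theorem IsCompleteDiscrete.exists_lt_one {k : Subfield Ω} (hk : IsCompleteDiscrete v k) :
    ∃ π : Ω, π ≠ 0 ∧ v π < 1 := by
  obtain ⟨π, -, h⟩ := hk.nontrivial
  exact ⟨π, h⟩

theorem closureSubfield_le (hv : ∃ π : Ω, π ≠ 0 ∧ v π < 1) {E F : Subfield Ω}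
    (hF : IsSeqComplete v (F : Set Ω)) (h : E ≤ F) : closureSubfield v E ≤ F := fun _ hx =>
  hF.mem_of_isLimitOf fun ε hε => by
    obtain ⟨y, hy, hxy⟩ := (mem_closureSubfield hv).1 hx ε hε
    exact ⟨y, h hy, hxy⟩

theorem le_closureSubfield (hv : ∃ π : Ω, π ≠ 0 ∧ v π < 1) (E : Subfield Ω) :
    E ≤ closureSubfield v E := fun x hx =>
  (mem_closureSubfield hv).2 fun ε hε => ⟨x, hx, by simpa using hε⟩

theorem closureSubfield_mono (hv : ∃ π : Ω, π ≠ 0 ∧ v π < 1) {E F : Subfield Ω} (h : E ≤ F) :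
    closureSubfield v E ≤ closureSubfield v F := fun _ hx =>
  (mem_closureSubfield hv).2 fun ε hε => by
    obtain ⟨y, hy, hxy⟩ := (mem_closureSubfield hv).1 hx ε hε
    exact ⟨y, h hy, hxy⟩

theorem isSeqComplete_closureSubfield (hv : ∃ π : Ω, π ≠ 0 ∧ v π < 1) {E F : Subfield Ω}
    (hF : IsSeqComplete v (F : Set Ω)) (h : E ≤ F) :
    IsSeqComplete v (closureSubfield v E : Set Ω) := by
  refine hF.of_closed (closureSubfield_le hv hF h) fun x hx => (mem_closureSubfield hv).2
    fun ε hε => ?_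
  obtain ⟨y, hy, hxy⟩ := hx ε hε
  obtain ⟨z, hz, hyz⟩ := (mem_closureSubfield hv).1 hy ε hε
  refine ⟨z, hz, ?_⟩
  rw [← sub_add_sub_cancel x y z]
  exact (Valuation.map_add v _ _).trans_lt (max_lt hxy hyz)

variable {B : Subfield Ω}

theorem constantBase_mono (hv : ∃ π : Ω, π ≠ 0 ∧ v π < 1) {E F : Subfield Ω} (h : E ≤ F) :
    constantBase v p B E ≤ constantBase v p B F := by
  obtain ⟨D, -, hD⟩ := constantBase_eq v p B
  rw [hD, hD]
  exact closureSubfield_mono hv (Subfield.closure_mono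
    (Set.union_subset_union_right _ (teichmullerSet_mono h)))

theorem teichmullerSet_subset_constantBase (hv : ∃ π : Ω, π ≠ 0 ∧ v π < 1) (E : Subfield Ω) :
    teichmullerSet v p E ⊆ constantBase v p B E := by
  obtain ⟨D, -, hD⟩ := constantBase_eq v p B
  rw [hD]
  exact Set.subset_union_right.trans (Subfield.subset_closure.trans (le_closureSubfield hv _))

theorem constantBase_le (hv : ∃ π : Ω, π ≠ 0 ∧ v π < 1) {E : Subfield Ω}
    (hE : IsSeqComplete v (E : Set Ω)) (hB : B ≤ E) : constantBase v p B E ≤ E := by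
  obtain ⟨D, hDB, hD⟩ := constantBase_eq v p B
  rw [hD]
  exact closureSubfield_le hv hE (Subfield.closure_le.2
    (Set.union_subset (hDB.trans hB) fun x hx => hx.1))

theorem isSeqComplete_constantBase (hv : ∃ π : Ω, π ≠ 0 ∧ v π < 1) {E : Subfield Ω}
    (hE : IsSeqComplete v (E : Set Ω)) (hB : B ≤ E) :
    IsSeqComplete v (constantBase v p B E : Set Ω) := by
  obtain ⟨D, hDB, hD⟩ := constantBase_eq v p B
  rw [hD]
  exact isSeqComplete_closureSubfield hv hE (Subfield.closure_le.2
    (Set.union_subset (hDB.trans hB) fun x hx => hx.1))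

/-- If `Q` is complete and contains the Teichmüller representatives of `E` as well as the field `k₀`
of some subfield of `E`, then it contains the field `k₀` of `E`. -/
theorem constantBase_le_of_teichmullerSet_subset (hv : ∃ π : Ω, π ≠ 0 ∧ v π < 1)
    {k E Q : Subfield Ω} (hQ : IsSeqComplete v (Q : Set Ω)) (hkQ : constantBase v p B k ≤ Q)
    (h : teichmullerSet v p E ⊆ Q) : constantBase v p B E ≤ Q := by
  obtain ⟨D, hDB, hD⟩ := constantBase_eq v p B
  rw [hD] at hkQ ⊢
  refine closureSubfield_le hv hQ (Subfield.closure_le.2 (Set.union_subset ?_ h))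
  exact Set.subset_union_left.trans
    (Subfield.subset_closure.trans ((le_closureSubfield hv _).trans hkQ))

variable (v p B) in
/-- The algebraic closure of `k₀(k)` in `Ω`: the compositum of all constant fields. -/
def constantClosure (k : Subfield Ω) : Subfield Ω :=
  (algebraicClosure (constantBase v p B k) Ω).toSubfield

theorem mem_constantClosure {k : Subfield Ω} {x : Ω} :
    x ∈ constantClosure v p B k ↔ IsAlgebraic (constantBase v p B k) x :=
  mem_algebraicClosure_iff

variable [hp : Fact p.Prime] [IsAlgClosed Ω]

/-- For a finite extension `E` of `k`, the field `k₀(E)` is contained in a finite extension `Q` of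
`k₀(k)`, generated by lifts of generators of the (finite) extension of maximal perfect residue
subfields. -/
theorem exists_isFiniteExt_constantBase {k E : Subfield Ω} (hk : IsCompleteDiscrete v k)
    (hvp : v (p : Ω) < 1) (hB : B ≤ k) (hkE : IsFiniteExt k E) :
    ∃ Q : Subfield Ω, IsFiniteExt (constantBase v p B k) Q ∧ constantBase v p B E ≤ Q := by
  have hv := hk.exists_lt_one
  have := charP_residueField hvp
  set k₀ := constantBase v p B k with hk₀
  have hk₀k : k₀ ≤ k := constantBase_le hv hk.complete hB
  obtain ⟨T, hTalg, hT⟩ :=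
    (IsFiniteExt.perfectCore (p := p) (hkE.residueSubfield (v := v))).exists_finset
  have hcore : perfectCore p (residueSubfield v k) ≤ residueSubfield v k₀ := fun a ha => by
    obtain ⟨x, hx, rfl⟩ := exists_mem_teichmullerSet hk.discrete hk.complete hvp fun n => by
      obtain ⟨b, hb, hba⟩ := mem_perfectCore.1 ha n
      exact ⟨b, hb, hba⟩
    exact mem_residueSubfield.2 ⟨x, teichmullerSet_subset_constantBase hv k hx, rfl⟩
  have hlift : ∀ a ∈ T, ∃ x : v.valuationSubring, IsAlgebraic k₀ (x : Ω) ∧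
      residue v.valuationSubring x = a := by
    intro a ha
    obtain ⟨f, x, hfm, hf, -, h0, hx⟩ := exists_lift_root (isAlgebraic_of_le hcore (hTalg a ha))
    obtain ⟨g, hg⟩ := exists_map_eq_of_coeff_mem v.valuationSubring.subtype hf
    refine ⟨x, ⟨g, ?_, ?_⟩, hx⟩
    · rintro rfl
      rw [Polynomial.map_zero] at hg
      exact (hfm.map v.valuationSubring.subtype).ne_zero hg.symm
    · rw [← Polynomial.eval_map_algebraMap, hg, eval_map_subtype, h0]
      rfl
  choose! θ hθalg hθ using hlift
  set S : Set Ω := (fun a => (θ a : Ω)) '' (T : Set (ResidueField v.valuationSubring)) with hS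
  have hSfin : S.Finite := T.finite_toSet.image _
  have hSalg : ∀ x ∈ S, IsAlgebraic k₀ x := by
    rintro _ ⟨a, ha, rfl⟩
    exact hθalg a ha
  have hQfin : IsFiniteExt k₀ (k₀ ⊔ Subfield.closure S) := isFiniteExt_sup_closure hSfin hSalg
  have hRfin : IsFiniteExt k (k ⊔ Subfield.closure S) :=
    isFiniteExt_sup_closure hSfin fun x _ => hk.isAlgebraic x
  set Q := k₀ ⊔ Subfield.closure S with hQ
  have hQR : Q ≤ E ⊔ (k ⊔ Subfield.closure S) :=
    (sup_le_sup_right hk₀k _).trans le_sup_right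
  have hQc : IsSeqComplete v (Q : Set Ω) :=
    (isSeqComplete_constantBase hv hk.complete hB).of_isFiniteExt hQfin
  have hRd : IsDiscreteSubfield v (E ⊔ (k ⊔ Subfield.closure S)) :=
    hk.discrete_of_isFiniteExt (hkE.sup hRfin)
  have hQd : IsDiscreteSubfield v Q := by
    obtain ⟨c, hc1, hc⟩ := hRd
    exact ⟨c, hc1, fun x hx => hc x (hQR hx)⟩
  have hcoreQ : perfectCore p (residueSubfield v E) ≤ residueSubfield v Q := by
    rw [hT]
    refine sup_le (hcore.trans (residueSubfield_mono le_sup_left)) (Subfield.closure_le.2 ?_)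
    intro a ha
    exact mem_residueSubfield.2 ⟨θ a, mem_sup_closure ⟨a, ha, rfl⟩, hθ a ha⟩
  refine ⟨Q, hQfin, constantBase_le_of_teichmullerSet_subset hv hQc le_sup_left fun x hx => ?_⟩
  have hx' : residue v.valuationSubring (⟨x, hx.2.1⟩ : v.valuationSubring) ∈
      perfectCore p (residueSubfield v E) := residue_mem_perfectCore hx
  obtain ⟨y, hy, hyx⟩ := exists_mem_teichmullerSet hQd hQc hvp fun n => by
    obtain ⟨b, hb, hba⟩ := exists_pow_eq_of_mem_perfectCore hx' n
    exact ⟨b, hcoreQ hb, hba⟩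
  have hxy : (y : Ω) = x := eq_of_mem_teichmullerSet (x := y) (y := ⟨x, hx.2.1⟩) hRd hvp
    (teichmullerSet_mono hQR hy) (teichmullerSet_mono le_sup_left hx) hyx
  rw [← hxy]
  exact hy.1

theorem constantClosure_eq {k E : Subfield Ω} (hk : IsCompleteDiscrete v k)
    (hvp : v (p : Ω) < 1) (hB : B ≤ k) (hkE : IsFiniteExt k E) :
    constantClosure v p B E = constantClosure v p B k := by
  ext x
  rw [mem_constantClosure, mem_constantClosure]
  obtain ⟨Q, hQ, hle⟩ := exists_isFiniteExt_constantBase hk hvp hB hkE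
  exact ⟨fun h => isAlgebraic_trans (fun y hy => hQ.isAlgebraic (hle hy)) h,
    isAlgebraic_of_le (constantBase_mono hk.exists_lt_one hkE.1)⟩

theorem constantSubfield_eq {k E : Subfield Ω} (hk : IsCompleteDiscrete v k)
    (hvp : v (p : Ω) < 1) (hB : B ≤ k) (hkE : IsFiniteExt k E) :
    constantSubfield v p B E = constantClosure v p B k ⊓ E := by
  rw [← constantClosure_eq hk hvp hB hkE]
  rfl

theorem mem_constantClosure_iff_isAlgebraic_constantSubfield {k E : Subfield Ω}
    (hk : IsCompleteDiscrete v k) (hvp : v (p : Ω) < 1) (hB : B ≤ k) (hkE : IsFiniteExt k E)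
    {x : Ω} : x ∈ constantClosure v p B k ↔ IsAlgebraic (constantSubfield v p B E) x := by
  rw [← constantClosure_eq hk hvp hB hkE, mem_constantClosure]
  have hle : constantBase v p B E ≤ constantSubfield v p B E :=
    le_inf (fun y hy => mem_constantClosure.2
        (isAlgebraic_algebraMap (⟨y, hy⟩ : constantBase v p B E)))
      (constantBase_le hk.exists_lt_one (hk.complete.of_isFiniteExt hkE) (hB.trans hkE.1))
  have hle' : constantSubfield v p B E ≤ constantClosure v p B E := inf_le_left
  exact ⟨isAlgebraic_of_le hle, isAlgebraic_trans fun y hy => mem_constantClosure.1 (hle' hy)⟩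

theorem isConstantExt_iff {k E F : Subfield Ω} (hk : IsCompleteDiscrete v k)
    (hvp : v (p : Ω) < 1) (hB : B ≤ k) (hkE : IsFiniteExt k E) :
    IsConstantExt v p B E F ↔ ∃ l ≤ constantClosure v p B k, F = l ⊔ E := by
  have hC := fun x => mem_constantClosure_iff_isAlgebraic_constantSubfield hk hvp hB hkE (x := x)
  constructor
  · rintro ⟨l, -, hl, rfl⟩
    exact ⟨l, fun x hx => (hC x).2 (hl x hx), rfl⟩
  · rintro ⟨l, hl, rfl⟩
    refine ⟨l ⊔ constantSubfield v p B E, le_sup_right, fun x hx => (hC x).1 ?_, ?_⟩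
    · rw [constantSubfield_eq hk hvp hB hkE] at hx
      exact (sup_le hl inf_le_left : l ⊔ _ ≤ _) hx
    · have hle : constantSubfield v p B E ≤ E := inf_le_right
      rw [sup_assoc, sup_eq_right.2 hle]

/-! ### Almost constant extensions -/

variable (v p B) in
/-- The largest almost constant extension of `k` inside `Ω`. -/
def almostConstantClosure (k : Subfield Ω) : Subfield Ω :=
  constantClosure v p B k ⊔ unramifiedClosure v k

theorem isAlmostConstantExt_iff {k E T : Subfield Ω} (hk : IsCompleteDiscrete v k)
    (hvp : v (p : Ω) < 1) (hB : B ≤ k) (hkE : IsFiniteExt k E) :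
    IsAlmostConstantExt v p B E T ↔ E ≤ T ∧ T ≤ E ⊔ almostConstantClosure v p B k := by
  have hA : E ⊔ almostConstantClosure v p B k =
      (constantClosure v p B k ⊔ E) ⊔ unramifiedClosure v E := by
    rw [almostConstantClosure, unramifiedClosure_eq_sup hk le_rfl hkE]
    ac_rfl
  rw [hA]
  constructor
  · rintro ⟨h, C, U, hC, hU, hle⟩
    refine ⟨h, hle.trans (sup_le_sup ?_ (hU.le_unramifiedClosure hk hkE))⟩
    obtain ⟨l, hl, rfl⟩ := (isConstantExt_iff hk hvp hB hkE).1 hC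
    exact sup_le_sup_right hl _
  · rintro ⟨h, hle⟩
    exact ⟨h, _, _, (isConstantExt_iff hk hvp hB hkE).2 ⟨_, le_rfl, rfl⟩,
      isUnramifiedExt_unramifiedClosure hk hkE.1, hle⟩

theorem maxAlmostConstant_eq {k E F : Subfield Ω} (hk : IsCompleteDiscrete v k)
    (hvp : v (p : Ω) < 1) (hB : B ≤ k) (hkE : IsFiniteExt k E) (hEF : E ≤ F) :
    maxAlmostConstant v p B E F = F ⊓ (E ⊔ almostConstantClosure v p B k) :=
  le_antisymm
    (sSup_le fun _ hT => le_inf hT.1 ((isAlmostConstantExt_iff hk hvp hB hkE).1 hT.2).2)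
    (le_sSup ⟨inf_le_left, (isAlmostConstantExt_iff hk hvp hB hkE).2
      ⟨le_inf hEF le_sup_left, inf_le_right⟩⟩)

end ConstantField

/-! ### Admissible extensions -/

section Admissible

open Polynomial

variable {Ω : Type*} [Field Ω]

/-- `L/k` is a finite Galois extension, expressed by a separable primitive element all of whose
conjugates lie in `L`. -/
def IsGaloisExt (k L : Subfield Ω) : Prop :=
  ∃ θ : Ω, IsSeparable k θ ∧ L = k ⊔ Subfield.closure {θ} ∧
    ∀ y, aeval y (minpoly k θ) = 0 → y ∈ L

theorem IsGaloisExt.isFiniteExt {k L : Subfield Ω} (h : IsGaloisExt k L) : IsFiniteExt k L := by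
  obtain ⟨θ, hθ, rfl, -⟩ := h
  exact isFiniteExt_sup_closure (Set.finite_singleton θ) fun x hx => by
    rw [Set.mem_singleton_iff.1 hx]
    exact hθ.isIntegral.isAlgebraic

theorem IsGaloisExt.isSeparable {k L E : Subfield Ω} (h : IsGaloisExt k L) (hkE : k ≤ E) {x : Ω}
    (hx : x ∈ E ⊔ L) : IsSeparable E x := by
  obtain ⟨θ, hθ, rfl, -⟩ := h
  rw [← sup_assoc, sup_eq_left.2 hkE] at hx
  refine isSeparable_of_mem_closure ?_ hx
  rintro _ rfl
  exact isSeparable_of_le hkE hθ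

theorem exists_finset_of_subset_sup_closure {G : Subfield Ω} {S : Set Ω} {T : Finset Ω}
    (hT : ∀ x ∈ T, x ∈ G ⊔ Subfield.closure S) :
    ∃ S' : Finset Ω, (S' : Set Ω) ⊆ S ∧ ∀ x ∈ T, x ∈ G ⊔ Subfield.closure (S' : Set Ω) := by
  classical
  have h : ∀ x ∈ T, ∃ S' : Finset Ω, (S' : Set Ω) ⊆ S ∧
      x ∈ G ⊔ Subfield.closure (S' : Set Ω) := fun x hx =>
    exists_finset_of_mem_sup_closure (hT x hx)
  choose! f hf hfx using h
  refine ⟨T.biUnion f, ?_, fun x hx => ?_⟩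
  · rw [Finset.coe_biUnion]
    exact Set.iUnion₂_subset hf
  · exact sup_le_sup_left (Subfield.closure_mono
      (Finset.coe_subset.2 (Finset.subset_biUnion_of_mem f hx))) G (hfx x hx)

variable {v : Valuation Ω ℝ≥0} {p : ℕ} {B : Subfield Ω}

theorem unramifiedClosure_le_almostConstantClosure (k : Subfield Ω) :
    unramifiedClosure v k ≤ almostConstantClosure v p B k := le_sup_right

theorem le_almostConstantClosure (k : Subfield Ω) : k ≤ almostConstantClosure v p B k :=
  (le_unramifiedClosure k).trans (unramifiedClosure_le_almostConstantClosure k)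

variable [IsAlgClosed Ω]

theorem IsGaloisExt.inf_sup_le {k L E M A : Subfield Ω} (h : IsGaloisExt k L)
    (hk : ∀ x : Ω, IsAlgebraic k x) (hkE : k ≤ E) (hEA : E ≤ A) (hML : M ≤ L) :
    (E ⊔ L) ⊓ (M ⊔ A) ≤ E ⊔ M ⊔ (L ⊓ A) := by
  obtain ⟨θ, hθ, hL, hn⟩ := h
  exact fun x hx => mem_of_mem_sup_of_galois hk hθ hL hn hkE hEA hML hx.1 hx.2

variable [hp : Fact p.Prime]

theorem isAdmissible_iff {k E L E' : Subfield Ω} (hk : IsCompleteDiscrete v k)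
    (hvp : v (p : Ω) < 1) (hB : B ≤ k) (hkE : IsFiniteExt k E) :
    IsAdmissible v p B E L E' ↔ IsFiniteExt E E' ∧ E' ≤ E ⊔ unramifiedClosure v k ∧
      (E' ⊔ L) ⊓ (E' ⊔ unramifiedClosure v k) ≤ E' ∧
      ∃ l ≤ constantClosure v p B k,
        (E' ⊔ L) ⊓ (E' ⊔ almostConstantClosure v p B k) = l ⊔ E' := by
  rw [IsAdmissible]
  refine and_congr_right fun hfin => ?_
  have hkE' := hkE.trans hfin
  rw [isUnramifiedExt_iff hk hkE, unramifiedClosure_eq_sup hk le_rfl hkE,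
    isConstantExt_iff hk hvp hB hkE', maxAlmostConstant_eq hk hvp hB hkE' le_sup_left]
  refine and_congr (and_iff_right hfin.1) (and_congr_left fun _ => ?_)
  simp only [isUnramifiedExt_iff hk hkE', unramifiedClosure_eq_sup hk le_rfl hkE']
  constructor
  · intro h
    exact (h _ inf_le_left ⟨le_inf le_sup_left le_sup_left, inf_le_right⟩).le
  · exact fun h T hT hT' => le_antisymm ((le_inf hT hT'.2).trans h) hT'.1

/-- Admissible extensions exist: as `L ∩ A` is finite over `k`, where `A` is the largest almost
constant extension, it lies in the compositum of a constant extension and a finite unramified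
one. -/
theorem exists_isAdmissible {k L : Subfield Ω} (hk : IsCompleteDiscrete v k)
    (hvp : v (p : Ω) < 1) (hB : B ≤ k) (hL : IsGaloisExt k L) :
    ∃ E, IsAdmissible v p B k L E := by
  set C := constantClosure v p B k with hC
  set U := unramifiedClosure v k with hU
  set A := almostConstantClosure v p B k with hA
  have hkU : k ≤ U := le_unramifiedClosure k
  have hUA : U ≤ A := unramifiedClosure_le_almostConstantClosure k
  have hkA : k ≤ A := hkU.trans hUA
  have hkL : k ≤ L := hL.isFiniteExt.1
  obtain ⟨T, -, hT⟩ :=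
    (hL.isFiniteExt.left (le_inf hkL hkA) (inf_le_left : L ⊓ A ≤ L)).exists_finset
  have hTA : ∀ x ∈ T, x ∈ (C ⊔ k) ⊔
      Subfield.closure (Subtype.val '' {x : v.valuationSubring | IsHenselRoot v k x}) := by
    intro x hx
    have h1 : x ∈ L ⊓ A := hT ▸ mem_sup_closure hx
    have h2 := h1.2
    rw [hA, almostConstantClosure, unramifiedClosure, ← sup_assoc] at h2
    exact h2
  obtain ⟨S, hS, hTS⟩ := exists_finset_of_subset_sup_closure hTA
  have hSU : k ⊔ Subfield.closure (S : Set Ω) ≤ U :=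
    sup_le_sup_left (Subfield.closure_mono hS) k
  have hfin : IsFiniteExt k ((k ⊔ Subfield.closure (S : Set Ω)) ⊔ (L ⊓ U)) :=
    (isFiniteExt_sup_closure S.finite_toSet fun x _ => hk.isAlgebraic x).sup
      (hL.isFiniteExt.left (le_inf hkL hkU) inf_le_left)
  set E := (k ⊔ Subfield.closure (S : Set Ω)) ⊔ (L ⊓ U) with hE
  have hEU : E ≤ U := sup_le hSU inf_le_right
  have hLA : L ⊓ A ≤ C ⊔ E := by
    have h1 : C ⊔ k ⊔ Subfield.closure (S : Set Ω) ≤ C ⊔ E := by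
      rw [sup_assoc]
      exact sup_le_sup_left le_sup_left C
    rw [hT]
    exact sup_le (hfin.1.trans le_sup_right)
      (Subfield.closure_le.2 fun x hx => h1 (hTS x hx))
  refine ⟨E, (isAdmissible_iff hk hvp hB (IsFiniteExt.refl k)).2
    ⟨hfin, hEU.trans le_sup_right, ?_, ((E ⊔ L) ⊓ (E ⊔ A)) ⊓ C, inf_le_right, ?_⟩⟩
  · have h1 := hL.inf_sup_le hk.isAlgebraic hfin.1 hEU hkL
    rw [sup_eq_right.2 hkU] at h1
    rw [sup_eq_right.2 hEU]
    exact h1.trans (sup_le (sup_le le_rfl hfin.1) le_sup_right)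
  · refine le_antisymm (fun x hx => ?_)
      (sup_le inf_le_left (le_inf le_sup_left le_sup_left))
    have h1 := hL.inf_sup_le hk.isAlgebraic hfin.1 (hEU.trans hUA) hkL
    rw [sup_eq_right.2 hkA] at h1
    have hxA : x ∈ A := by
      have := hx.2
      rwa [sup_eq_right.2 (hEU.trans hUA)] at this
    have hxC : x ∈ C ⊔ E :=
      (sup_le (sup_le le_sup_right (hfin.1.trans le_sup_right)) hLA : _ ≤ C ⊔ E) (h1 ⟨hx.1, hxA⟩)
    exact mem_of_mem_sup_of_separable (fun z => isAlgebraic_of_le hfin.1 (hk.isAlgebraic z))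
      (fun z => mem_constantClosure)
      ((constantBase_le hk.exists_lt_one hk.complete hB).trans hfin.1)
      (le_inf le_sup_left le_sup_left) hx hxC (hL.isSeparable hfin.1 hx.1)

theorem IsAdmissible.sup {k L M E : Subfield Ω} (hk : IsCompleteDiscrete v k)
    (hvp : v (p : Ω) < 1) (hB : B ≤ k) (hL : IsGaloisExt k L) (hkM : k ≤ M) (hML : M ≤ L)
    (hE : IsAdmissible v p B k L E) : IsAdmissible v p B M L (E ⊔ M) := by
  have hkM' := hL.isFiniteExt.left hkM hML
  obtain ⟨hfin, hEU, hu, l, hl, hlE⟩ := (isAdmissible_iff hk hvp hB (IsFiniteExt.refl k)).1 hE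
  have hkU : k ≤ unramifiedClosure v k := le_unramifiedClosure k
  rw [sup_eq_right.2 hkU] at hEU
  have hUA : unramifiedClosure v k ≤ almostConstantClosure v p B k :=
    unramifiedClosure_le_almostConstantClosure k
  have hEL : E ⊔ M ⊔ L = E ⊔ L := by rw [sup_assoc, sup_eq_right.2 hML]
  have hcomm : ∀ X, E ≤ X → E ⊔ M ⊔ X = M ⊔ X := fun X hX => by
    rw [sup_comm E M, sup_assoc, sup_eq_right.2 hX]
  have hfin' : IsFiniteExt M (E ⊔ M) := by
    rw [sup_comm]
    exact hfin.sup_left hkM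
  refine (isAdmissible_iff hk hvp hB hkM').2
    ⟨hfin', sup_le (hEU.trans le_sup_right) le_sup_left, ?_, l, hl, ?_⟩
  · rw [hEL, hcomm _ hEU]
    exact (hL.inf_sup_le hk.isAlgebraic hfin.1 hEU hML).trans
      (sup_le le_rfl ((inf_le_inf le_sup_right le_sup_right).trans (hu.trans le_sup_left)))
  · rw [hEL, hcomm _ (hEU.trans hUA)]
    refine le_antisymm ((hL.inf_sup_le hk.isAlgebraic hfin.1 (hEU.trans hUA) hML).trans
      (sup_le le_sup_right ?_)) (sup_le ?_ ?_)
    · refine (inf_le_inf le_sup_right le_sup_right).trans (hlE.le.trans ?_)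
      exact sup_le_sup_left le_sup_left l
    · refine le_trans (le_sup_left.trans hlE.ge) (inf_le_inf le_rfl ?_)
      exact (sup_le (hEU.trans hUA) le_rfl).trans le_sup_right
    · exact sup_le (le_inf le_sup_left ((hEU.trans hUA).trans le_sup_right))
        (le_inf (hML.trans le_sup_right) le_sup_left)

theorem maxAlmostConstant_eq_sup {k L M : Subfield Ω} (hk : IsCompleteDiscrete v k)
    (hvp : v (p : Ω) < 1) (hB : B ≤ k) (hL : IsGaloisExt k L) (hkM : k ≤ M) (hML : M ≤ L) :
    maxAlmostConstant v p B M L = M ⊔ maxAlmostConstant v p B k L := by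
  have hkA : k ≤ almostConstantClosure v p B k := le_almostConstantClosure k
  have hkL := hkM.trans hML
  rw [maxAlmostConstant_eq hk hvp hB (hL.isFiniteExt.left hkM hML) hML,
    maxAlmostConstant_eq hk hvp hB (IsFiniteExt.refl k) hkL, sup_eq_right.2 hkA]
  refine le_antisymm ?_ (sup_le (le_inf hML le_sup_left) (inf_le_inf le_rfl le_sup_right))
  have h := hL.inf_sup_le hk.isAlgebraic le_rfl hkA hML
  rwa [sup_eq_right.2 hkL, sup_eq_right.2 hkM] at h

/-- The conditions on the auxiliary extension `l'` in the definition of the subgroups `G_{i,i}` do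
not depend on the base field: the constants of `l'M(L ∩ A)` already lie in `l'(L ∩ A)`. -/
theorem isStandard_and_hasRamificationIndexOne_iff {k L M l : Subfield Ω}
    (hk : IsCompleteDiscrete v k) (hvp : v (p : Ω) < 1) (hB : B ≤ k) (hL : IsGaloisExt k L)
    (hkM : k ≤ M) (hML : M ≤ L) (hl : IsFiniteExt (constantSubfield v p B L) l) :
    (IsStandard v p B (l ⊔ maxAlmostConstant v p B M L) ∧
      HasRamificationIndexOne v (l ⊔ maxAlmostConstant v p B M L) (l ⊔ L)) ↔
    (IsStandard v p B (l ⊔ maxAlmostConstant v p B k L) ∧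
      HasRamificationIndexOne v (l ⊔ maxAlmostConstant v p B k L) (l ⊔ L)) := by
  rw [maxAlmostConstant_eq_sup hk hvp hB hL hkM hML]
  have hkA : k ≤ almostConstantClosure v p B k := le_almostConstantClosure k
  have hkL := hkM.trans hML
  have hmax : maxAlmostConstant v p B k L = L ⊓ almostConstantClosure v p B k := by
    rw [maxAlmostConstant_eq hk hvp hB (IsFiniteExt.refl k) hkL, sup_eq_right.2 hkA]
  rw [hmax]
  set A := almostConstantClosure v p B k with hA
  set C := constantClosure v p B k with hC
  have hlC : l ≤ C := fun x hx => (mem_constantClosure_iff_isAlgebraic_constantSubfield hk hvp hB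
    hL.isFiniteExt).2 (hl.isAlgebraic hx)
  have hCA : C ≤ A := le_sup_left
  set Y := l ⊔ (L ⊓ A) with hY
  set X := l ⊔ (M ⊔ (L ⊓ A)) with hX
  have hYX : Y ≤ X := sup_le_sup_left le_sup_right l
  have hXN : X ≤ l ⊔ L := sup_le_sup_left (sup_le hML inf_le_left) l
  have hkLA : k ≤ L ⊓ A := le_inf hkL hkA
  have hkY : k ≤ Y := hkLA.trans le_sup_right
  have hkN : IsFiniteExt k (l ⊔ L) := by
    have h1 : constantSubfield v p B L ≤ L := inf_le_right
    have h2 := hl.sup_left h1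
    rw [sup_comm] at h2
    exact hL.isFiniteExt.trans h2
  have hCX : C ⊓ X ≤ Y := by
    have h1 := hL.inf_sup_le (M := k) hk.isAlgebraic (le_sup_left : k ≤ k ⊔ l)
      (sup_le hkA (hlC.trans hCA)) hkL
    refine (le_trans (le_inf (inf_le_right.trans (hXN.trans ?_)) (inf_le_left.trans
      (hCA.trans le_sup_right))) h1).trans ?_
    · exact sup_le_sup_right le_sup_right L
    · exact sup_le (sup_le (sup_le hkY le_sup_left) hkY) le_sup_right
  have hkX' : constantSubfield v p B X = C ⊓ X :=
    constantSubfield_eq hk hvp hB (hkN.left (hkY.trans hYX) hXN)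
  have hkY' : constantSubfield v p B Y = C ⊓ Y :=
    constantSubfield_eq hk hvp hB (hkN.left hkY (hYX.trans hXN))
  have hXY : C ⊓ X = C ⊓ Y :=
    le_antisymm (le_inf inf_le_left hCX) (inf_le_inf le_rfl hYX)
  rw [IsStandard, IsStandard, hkX', hkY', hXY]
  constructor
  · rintro ⟨h1, h2⟩
    have h3 : ∀ x ∈ l ⊔ L, ∃ y ∈ C ⊓ Y, v x = v y := fun x hx => by
      obtain ⟨y, hy, hxy⟩ := h2.2 x hx
      obtain ⟨z, hz, hyz⟩ := h1.2 y hy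
      exact ⟨z, hz, hxy.trans hyz⟩
    exact ⟨⟨inf_le_right, fun x hx => h3 x (hXN (hYX hx))⟩, hYX.trans hXN, fun x hx => by
      obtain ⟨y, hy, hxy⟩ := h3 x hx
      exact ⟨y, hy.2, hxy⟩⟩
  · rintro ⟨h1, h2⟩
    have h3 : ∀ x ∈ l ⊔ L, ∃ y ∈ C ⊓ Y, v x = v y := fun x hx => by
      obtain ⟨y, hy, hxy⟩ := h2.2 x hx
      obtain ⟨z, hz, hyz⟩ := h1.2 y hy
      exact ⟨z, hz, hxy.trans hyz⟩
    exact ⟨⟨inf_le_right.trans hYX, fun x hx => h3 x (hXN hx)⟩, hXN, fun x hx => by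
      obtain ⟨y, hy, hxy⟩ := h3 x hx
      exact ⟨y, hYX hy.2, hxy⟩⟩

end Admissible

/-! ### Complete discretely valued ground fields -/

section Ground

open Polynomial Filter Topology

variable {K Ω : Type*} [NontriviallyNormedField K] [Field Ω] [Algebra K Ω]
  [Algebra.IsAlgebraic K Ω]

theorem isAlgebraic_fieldRange (x : Ω) : IsAlgebraic (algebraMap K Ω).fieldRange x := by
  let _ : Algebra K (algebraMap K Ω).fieldRange := (algebraMap K Ω).rangeRestrictField.toAlgebra
  have : IsScalarTower K (algebraMap K Ω).fieldRange Ω :=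
    IsScalarTower.of_algebraMap_eq fun _ => rfl
  exact (Algebra.IsAlgebraic.isAlgebraic (R := K) x).tower_top _

variable [IsUltrametricDist K]

theorem norm_natCast_lt_one {p : ℕ}
    [CharP (IsLocalRing.ResidueField (NormedField.valuation (K := K)).valuationSubring) p] :
    ‖(p : K)‖ < 1 := by
  have h := CharP.cast_eq_zero
    (IsLocalRing.ResidueField (NormedField.valuation (K := K)).valuationSubring) p
  rw [← map_natCast (IsLocalRing.residue _), residue_eq_zero_iff_lt] at h
  exact_mod_cast h

variable [CompleteSpace K]

theorem isCompleteDiscrete_prolongedValuation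
    [IsDiscreteValuationRing (NormedField.valuation (K := K)).valuationSubring] :
    IsCompleteDiscrete (prolongedValuation K Ω) (algebraMap K Ω).fieldRange where
  isAlgebraic := isAlgebraic_fieldRange
  map_eq σ hσ x := by
    let τ : Ω ≃ₐ[K] Ω := AlgEquiv.ofRingEquiv (f := σ) fun r => hσ _ ⟨r, rfl⟩
    exact NNReal.eq (spectralNorm_eq_of_equiv τ x).symm
  complete s hs hc := by
    choose a ha using hs
    obtain rfl : (fun n => algebraMap K Ω (a n)) = s := funext ha
    have h1 : Tendsto (fun n => a (n + 1) - a n) atTop (𝓝 0) := by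
      rw [tendsto_zero_iff_norm_tendsto_zero]
      simp only [← map_sub, prolongedValuation_algebraMap] at hc
      exact (NNReal.tendsto_coe (x := 0)).2 hc
    have h2 : CauchySeq a := NonarchimedeanAddGroup.cauchySeq_of_tendsto_sub_nhds_zero h1
    obtain ⟨b, hb⟩ := cauchySeq_tendsto_of_complete h2
    refine ⟨algebraMap K Ω b, ⟨b, rfl⟩, ?_⟩
    simp only [← map_sub, prolongedValuation_algebraMap]
    have h3 := (tendsto_const_nhds (x := b)).sub hb
    rw [sub_self] at h3
    have h4 := h3.nnnorm
    rwa [nnnorm_zero] at h4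
  discrete := by
    obtain ⟨ϖ, hϖ⟩ := IsDiscreteValuationRing.exists_irreducible
      (NormedField.valuation (K := K)).valuationSubring
    refine ⟨‖(ϖ : K)‖₊, (Valuation.mem_maximalIdeal_iff _ _).1 hϖ.not_isUnit, ?_⟩
    rintro _ ⟨x, rfl⟩ hx
    rw [prolongedValuation_algebraMap] at hx ⊢
    have hx' : (⟨x, hx.le⟩ : (NormedField.valuation (K := K)).valuationSubring) ∈
        IsLocalRing.maximalIdeal _ := (Valuation.mem_maximalIdeal_iff _ _).2 hx
    rw [hϖ.maximalIdeal_eq, Ideal.mem_span_singleton] at hx'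
    obtain ⟨y, hy⟩ := hx'
    have h1 : x = ϖ * y := congrArg Subtype.val hy
    rw [h1, nnnorm_mul]
    exact mul_le_of_le_one_right zero_le y.2
  nontrivial := by
    obtain ⟨x, hx0, hx1⟩ := NormedField.exists_norm_lt_one K
    refine ⟨algebraMap K Ω x, ⟨x, rfl⟩, ?_, ?_⟩
    · simpa using hx0
    · rw [prolongedValuation_algebraMap]
      exact hx1

end Ground

section Galois

open Polynomial

variable {K L Ω : Type*} [Field K] [Field L] [Algebra K L]

theorem isGaloisExt_fieldRange [FiniteDimensional K L] [IsGalois K L] [Field Ω] [Algebra K Ω]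
    [Algebra L Ω] [IsScalarTower K L Ω] :
    IsGaloisExt (algebraMap K Ω).fieldRange (algebraMap L Ω).fieldRange := by
  let _ : Algebra K (algebraMap K Ω).fieldRange := (algebraMap K Ω).rangeRestrictField.toAlgebra
  have : IsScalarTower K (algebraMap K Ω).fieldRange Ω :=
    IsScalarTower.of_algebraMap_eq fun _ => rfl
  obtain ⟨θ, hθ⟩ := Field.exists_primitive_element K L
  have hsep : IsSeparable K (algebraMap L Ω θ) :=
    (Algebra.IsSeparable.isSeparable K θ).map (f := IsScalarTower.toAlgHom K L Ω)
      (algebraMap L Ω).injective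
  refine ⟨algebraMap L Ω θ, hsep.tower_top _, ?_, fun y hy => ?_⟩
  · have h1 := congrArg (fun N => (IntermediateField.map (IsScalarTower.toAlgHom K L Ω) N).toSubfield)
      hθ
    simp only [IntermediateField.adjoin_map, Set.image_singleton] at h1
    rw [IntermediateField.adjoin_toSubfield, Subfield.closure_union] at h1
    have h2 : Subfield.closure (Set.range (algebraMap K Ω)) = (algebraMap K Ω).fieldRange := by
      rw [← RingHom.coe_fieldRange, Subfield.closure_eq]
    rw [h2] at h1
    refine Eq.trans ?_ h1.symm
    ext x
    simp
  · have h1 := aeval_eq_zero_of_dvd_aeval_eq_zero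
      (minpoly.dvd_map_of_isScalarTower K (algebraMap K Ω).fieldRange (algebraMap L Ω θ)) hy
    rw [aeval_map_algebraMap, minpoly.algebraMap_eq (algebraMap L Ω).injective] at h1
    have hsp : ((minpoly K θ).map (algebraMap K L)).Splits := Normal.splits inferInstance θ
    refine hsp.mem_range_of_isRoot ((minpoly.monic (Algebra.IsIntegral.isIntegral θ)).map _).ne_zero
      (i := algebraMap L Ω) ?_
    rwa [Polynomial.map_map, ← IsScalarTower.algebraMap_eq, IsRoot, eval_map_algebraMap]

variable (H : Subgroup (L ≃ₐ[K] L))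

theorem Extends.eq_of_mem_imageSubfield {A L Ω : Type*} [Field A] [Field L] [Algebra A L] [Field Ω]
    [Algebra L Ω] {σ : Ω ≃+* Ω} {g : L ≃ₐ[A] L} (h : Extends σ g) :
    ∀ x ∈ imageSubfield A L Ω, σ x = x := by
  rintro _ ⟨x, rfl⟩
  exact (h (algebraMap A L x)).trans (congrArg _ (g.commutes x))

theorem mem_of_restrictScalars [FiniteDimensional K L]
    (g : L ≃ₐ[IntermediateField.fixedField H] L) :
    AlgEquiv.restrictScalars K g ∈ H := by
  have h : AlgEquiv.restrictScalars K g ∈ (IntermediateField.fixedField H).fixingSubgroup :=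
    (IntermediateField.mem_fixingSubgroup_iff _ _).2 fun x hx => g.commutes ⟨x, hx⟩
  rwa [IntermediateField.fixingSubgroup_fixedField] at h

theorem exists_restrictScalars_eq {g : L ≃ₐ[K] L} (hg : g ∈ H) :
    ∃ g' : L ≃ₐ[IntermediateField.fixedField H] L, AlgEquiv.restrictScalars K g' = g :=
  ⟨AlgEquiv.ofRingEquiv (f := g.toRingEquiv) fun x => x.2 ⟨g, hg⟩, AlgEquiv.ext fun _ => rfl⟩

theorem image_restrictScalars_eq [FiniteDimensional K L]
    {S : Set (L ≃ₐ[IntermediateField.fixedField H] L)}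
    {T : Set (L ≃ₐ[K] L)} (h : ∀ g, g ∈ S ↔ AlgEquiv.restrictScalars K g ∈ T) :
    (AlgEquiv.restrictScalars K : (L ≃ₐ[IntermediateField.fixedField H] L) → (L ≃ₐ[K] L)) '' S =
      (H : Set (L ≃ₐ[K] L)) ∩ T := by
  ext g
  constructor
  · rintro ⟨g', hg', rfl⟩
    exact ⟨mem_of_restrictScalars H g', (h g').1 hg'⟩
  · rintro ⟨hg, hgT⟩
    obtain ⟨g', rfl⟩ := exists_restrictScalars_eq H hg
    exact ⟨g', (h g').2 hgT, rfl⟩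

end Galois

end LowerRamification

end

open LowerRamification in
theorem proposition1p2
    (p : ℕ) [Fact p.Prime]
    {K : Type*} [NontriviallyNormedField K] [CompleteSpace K] [IsUltrametricDist K]
    [IsDiscreteValuationRing (NormedField.valuation (K := K)).valuationSubring]
    [CharP (IsLocalRing.ResidueField (NormedField.valuation (K := K)).valuationSubring) p]
    (hres : Module.finrank
      (frobenius (IsLocalRing.ResidueField
        (NormedField.valuation (K := K)).valuationSubring) p).fieldRange
      (IsLocalRing.ResidueField (NormedField.valuation (K := K)).valuationSubring) = p)
    (B : Subfield K) (hB : CharP K p → IsBaseSubfield B)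
    {L : Type*} [Field L] [Algebra K L] [FiniteDimensional K L] [IsGalois K L]
    (H : Subgroup (L ≃ₐ[K] L))
    (Ω : Type*) [Field Ω] [Algebra K Ω] [Algebra L Ω] [IsScalarTower K L Ω] [IsAlgClosure K Ω]
    [Algebra.IsAlgebraic K Ω] :
    let v := prolongedValuation K Ω
    let B' := B.map (algebraMap K Ω)
    let K' := imageSubfield K L Ω
    let L' := (algebraMap L Ω).fieldRange
    let M' := imageSubfield (IntermediateField.fixedField H) L Ω
    (∃ E, IsAdmissible v p B' K' L' E) ∧
    ∀ E, IsAdmissible v p B' K' L' E →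
      IsAdmissible v p B' M' L' (E ⊔ M') ∧
      ∀ α : RamIndex,
        (AlgEquiv.restrictScalars K : (L ≃ₐ[IntermediateField.fixedField H] L) → (L ≃ₐ[K] L)) ''
            ramificationGroup (A := IntermediateField.fixedField H) v p B' (E ⊔ M') α =
          (H : Set (L ≃ₐ[K] L)) ∩ ramificationGroup (A := K) v p B' E α := by
  intro v B' K' L' M'
  have : IsAlgClosed Ω := IsAlgClosure.isAlgClosed K
  have hK' : K' = (algebraMap K Ω).fieldRange := by
    rw [IsScalarTower.algebraMap_eq K L Ω]
    rfl
  have hk : IsCompleteDiscrete v K' := hK' ▸ isCompleteDiscrete_prolongedValuation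
  have hvp : v (p : Ω) < 1 := by
    rw [← map_natCast (algebraMap K Ω) p, prolongedValuation_algebraMap]
    exact norm_natCast_lt_one
  have hBK : B' ≤ K' := by
    rw [hK']
    rintro _ ⟨x, -, rfl⟩
    exact ⟨x, rfl⟩
  have hL : IsGaloisExt K' L' := hK' ▸ isGaloisExt_fieldRange
  have hML : M' ≤ L' := by
    rintro _ ⟨x, rfl⟩
    exact ⟨_, rfl⟩
  have hKM : K' ≤ M' := by
    rintro _ ⟨x, rfl⟩
    exact ⟨algebraMap K _ x, rfl⟩
  refine ⟨exists_isAdmissible hk hvp hBK hL, fun E hE =>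
    ⟨hE.sup hk hvp hBK hL hKM hML, fun α => image_restrictScalars_eq H fun g => ?_⟩⟩
  have hmax := maxAlmostConstant_eq_sup hk hvp hBK hL hKM hML
  cases α with
  | negOne => exact Iff.rfl
  | zero => exact Iff.rfl
  | const i hi =>
    have hEL : E ⊔ M' ⊔ L' = E ⊔ L' := by rw [sup_assoc, sup_eq_right.2 hML]
    change InConst v p B' (E ⊔ M') i g ↔ InConst v p B' E i (AlgEquiv.restrictScalars K g)
    have hfix : ∀ σ : Ω ≃+* Ω, Extends σ g →
        ((∀ x ∈ E ⊔ M', σ x = x) ↔ ∀ x ∈ E, σ x = x) := fun σ hσ =>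
      ⟨fun h x hx => h x ((le_sup_left : E ≤ E ⊔ M') hx), fun h x hx =>
        eq_of_mem_sup (τ := RingEquiv.refl Ω) h (hσ.eq_of_mem_imageSubfield) hx⟩
    unfold InConst
    rw [hEL]
    exact exists_congr fun σ => and_congr_right fun hσ => and_congr_left fun _ => hfix σ hσ
  | constInfty =>
    change (∀ x : L, algebraMap L Ω x ∈ maxAlmostConstant v p B' M' L' → g x = x) ↔
      ∀ x : L, algebraMap L Ω x ∈ maxAlmostConstant v p B' K' L' → g x = x
    rw [hmax]
    refine ⟨fun h x hx => h x ((le_sup_right : _ ≤ M' ⊔ _) hx), fun h x hx => ?_⟩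
    set F : Subfield Ω :=
      ((g : L →+* L).eqLocusField (RingHom.id L)).map (algebraMap L Ω) with hF
    have hle : M' ⊔ maxAlmostConstant v p B' K' L' ≤ F := by
      refine sup_le ?_ fun y hy => ?_
      · rintro _ ⟨y, rfl⟩
        exact ⟨algebraMap _ L y, g.commutes y, rfl⟩
      · have hyL : y ∈ L' := (sSup_le fun T hT => hT.1 : maxAlmostConstant v p B' K' L' ≤ L') hy
        obtain ⟨z, rfl⟩ := hyL
        exact ⟨z, h z hy, rfl⟩
    obtain ⟨z, hz, hzx⟩ := hle hx
    rw [← (algebraMap L Ω).injective hzx]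
    exact hz
  | infernal i hi =>
    change InInfernal v p B' i g ↔ InInfernal v p B' i (AlgEquiv.restrictScalars K g)
    unfold InInfernal
    refine exists_congr fun σ => and_congr_right fun hσ => exists_congr fun l => ?_
    have hfix : (∀ x ∈ l ⊔ maxAlmostConstant v p B' M' L', σ x = x) ↔
        ∀ x ∈ l ⊔ maxAlmostConstant v p B' K' L', σ x = x := by
      rw [hmax, sup_left_comm]
      exact ⟨fun h x hx => h x ((le_sup_right : _ ≤ M' ⊔ _) hx), fun h x hx =>
        eq_of_mem_sup (τ := RingEquiv.refl Ω) (hσ.eq_of_mem_imageSubfield) h hx⟩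
    constructor
    · rintro ⟨Ac, N, hl, rfl, rfl, h1, h2, h3, h4⟩
      obtain ⟨h1, h2⟩ := (isStandard_and_hasRamificationIndexOne_iff hk hvp hBK hL hKM hML hl).1
        ⟨h1, h2⟩
      exact ⟨_, _, hl, rfl, rfl, h1, h2, hfix.1 h3, h4⟩
    · rintro ⟨Ac, N, hl, rfl, rfl, h1, h2, h3, h4⟩
      obtain ⟨h1, h2⟩ := (isStandard_and_hasRamificationIndexOne_iff hk hvp hBK hL hKM hML hl).2
        ⟨h1, h2⟩
      exact ⟨_, _, hl, rfl, rfl, h1, h2, hfix.2 h3, h4⟩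
  | infty =>
    exact ⟨fun h => congrArg (AlgEquiv.restrictScalars K) h,
      fun h => AlgEquiv.restrictScalars_injective K h⟩
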